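/- For an integer $d\ge 4$, call a $C^2$ function $u\ge 0$ on $(1,\infty)$ a nonnegative solution if $$u''(r)+\frac{d-1}{r}\,u'(r)=4u(r)^2\qquad (r>1).$$ There is a (unique) maximal nonnegative solution $u_1=u_{1,d}$, that is, a nonnegative solution with $v\le u_1$ on $(1,\infty)$ for every nonnegative solution $v$. It has the following properties. (i) If $d\ge 5$, there are constants $a_0,b_0,b_1'>0$ depending only on $d$ such that $\lim_{r\to\infty} r^{d-2}u_1(r)=a_0$, and $$u_1(r)\ge a_0\,r^{2-d}\quad (r>1),\qquad u_1(r)\le b_0\,r^{2-d}\quad\text{and}\quad u_1(r)\le a_0\,r^{2-d}+b_1'\,r^{6-2d}\quad (r\ge 4/3).$$ (ii) If $d=4$, then $\lim_{r\to\infty} r^{2}\log(r)\,u_1(r)=\tfrac12$, and $$u_1(r)\ge \frac{1}{2r^2\log(2r)}\quad (r>1);$$ there is a constant $b_0>0$ such that $$u_1(r)\le \frac{b_0}{2r^2\log r}\quad (r\ge 4/3);$$ and for every $\rho>e$ there is a constant $b_1'>0$, depending only on $\rho$, such that $$u_1(r)\le \frac{1}{2r^2\log r}+\frac{b_1'\,\log(\log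 r)}{r^2(\log r)^2}\quad (r\ge\rho).$$ -/

import Mathlib

open Set Filter Topology

/-- `u` is a nonnegative classical (`C²`) solution on `(1, ∞)` of
`u'' + ((d - 1) / r) u' = 4 u²`. Only the values of `u` on `(1, ∞)` matter. -/
structure IsNonnegSolution (d : ℕ) (u : ℝ → ℝ) : Prop where
  contDiffOn : ContDiffOn ℝ 2 u (Ioi 1)
  nonneg : ∀ r : ℝ, 1 < r → 0 ≤ u r
  ode : ∀ r : ℝ, 1 < r →
    deriv (deriv u) r + ((d : ℝ) - 1) / r * deriv u r = 4 * u r ^ 2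

/-- `u` is the maximal nonnegative solution on `(1, ∞)`: a nonnegative solution that dominates
every nonnegative solution. Two such functions agree on `(1, ∞)`. -/
structure IsMaximalNonnegSolution (d : ℕ) (u : ℝ → ℝ) : Prop where
  isNonnegSolution : IsNonnegSolution d u
  le_of_isNonnegSolution : ∀ v : ℝ → ℝ, IsNonnegSolution d v → ∀ r : ℝ, 1 < r → v r ≤ u r

/-!
In terms of the flux `h = (d - 2) u + r u'` the equation is the first-order identity
`h' = 4 r u ^ 2`. A Keller–Osserman barrier bounds all nonnegative solutions locally uniformly and
forces `u → 0` at infinity, so by the maximum principle two solutions never cross. Hence solutions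
are totally ordered, and the difference of two of them is nonincreasing in `r`: convergence at a
point propagates to the right. Solutions almost optimal at `1 + ε` with `ε → 0` therefore converge
everywhere to the pointwise supremum, and such limits solve the equation.

The bounds from below come from subsolutions: a linear term added to both sides of the equation
makes the associated Green operator order preserving, so by the Knaster–Tarski argument a solution
lies above every suitable subsolution.

For the asymptotics, `m = r ^ (d - 2) u` is nonincreasing and integrating `h' = 4 r u ^ 2` from
infinity controls `h` through `m`. If `d ≥ 5`, this gives `m ≤ a + m ^ 2 / r ^ (d - 4)`, so the
limit `a` of `m` is not zero when `u > 0`. If `d = 4`, it gives `(1 / m)' = 2 / r + O(m / r)` with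
`m → 0`, whence `1 / m` grows like `2 log r`.
-/

theorem deriv_deriv_nonneg_of_isLocalMin {f : ℝ → ℝ} {x : ℝ} (hmin : IsLocalMin f x)
    (hf : ContinuousAt f x) : 0 ≤ deriv (deriv f) x := by
  by_contra! hneg
  have hmax : IsLocalMax f x := isLocalMax_of_deriv_deriv_neg hneg hmin.deriv_eq_zero hf
  have hconst : f =ᶠ[𝓝 x] fun _ => f x := by
    filter_upwards [hmin, hmax] with y hle hge using le_antisymm hge hle
  simp [hconst.deriv.deriv_eq] at hneg

theorem nonneg_of_deriv_deriv_add_neg {I : Set ℝ} (hI : IsOpen I) {D D' D'' c : ℝ → ℝ}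
    (hD : ∀ x ∈ I, HasDerivAt D (D' x) x) (hD' : ∀ x ∈ I, HasDerivAt D' (D'' x) x)
    (hneg : ∀ x ∈ I, D x < 0 → D'' x + c x * D' x < 0)
    (hbdry : ∀ ε > 0, ∃ K ⊆ I, IsCompact K ∧ ∀ x ∈ I, x ∉ K → -ε ≤ D x) {x : ℝ} (hx : x ∈ I) :
    0 ≤ D x := by
  by_contra! hDx
  obtain ⟨K, hKI, hK, hout⟩ := hbdry (-D x / 2) (by linarith)
  have hxK : x ∈ K := by
    by_contra hxK
    linarith [hout x hx hxK]
  obtain ⟨y, hyK, hyK_min⟩ := hK.exists_isMinOn ⟨x, hxK⟩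
    fun z hz => (hD z (hKI hz)).continuousAt.continuousWithinAt
  have hyI : y ∈ I := hKI hyK
  have hyx : D y ≤ D x := hyK_min hxK
  have hmin : IsLocalMin D y := by
    filter_upwards [hI.mem_nhds hyI] with z hz
    by_cases hzK : z ∈ K
    · exact hyK_min hzK
    · linarith [hout z hz hzK]
  have hderiv : deriv D =ᶠ[𝓝 y] D' := by
    filter_upwards [hI.mem_nhds hyI] with z hz using (hD z hz).deriv
  have hsecond : 0 ≤ D'' y := by
    rw [← (hD' y hyI).deriv, ← hderiv.deriv_eq]
    exact deriv_deriv_nonneg_of_isLocalMin hmin (hD y hyI).continuousAt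
  have hLD := hneg y hyI (by linarith)
  rw [hmin.hasDerivAt_eq_zero (hD y hyI)] at hLD
  linarith

theorem monotoneOn_Ioi_of_hasDerivAt_nonneg {f f' : ℝ → ℝ} {a : ℝ}
    (hf : ∀ x, a < x → HasDerivAt f (f' x) x) (hf' : ∀ x, a < x → 0 ≤ f' x) :
    MonotoneOn f (Ioi a) :=
  monotoneOn_of_hasDerivWithinAt_nonneg (convex_Ioi a)
    (fun x hx => (hf x hx).continuousAt.continuousWithinAt)
    (fun x hx => (hf x (interior_subset hx)).hasDerivWithinAt)
    (fun x hx => hf' x (interior_subset hx))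

theorem antitoneOn_Ioi_of_hasDerivAt_nonpos {f f' : ℝ → ℝ} {a : ℝ}
    (hf : ∀ x, a < x → HasDerivAt f (f' x) x) (hf' : ∀ x, a < x → f' x ≤ 0) :
    AntitoneOn f (Ioi a) :=
  antitoneOn_of_hasDerivWithinAt_nonpos (convex_Ioi a)
    (fun x hx => (hf x hx).continuousAt.continuousWithinAt)
    (fun x hx => (hf x (interior_subset hx)).hasDerivWithinAt)
    (fun x hx => hf' x (interior_subset hx))

theorem le_of_hasDerivAt_le_of_tendsto_sub {f g f' g' : ℝ → ℝ} {a : ℝ}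
    (hf : ∀ x, a < x → HasDerivAt f (f' x) x) (hg : ∀ x, a < x → HasDerivAt g (g' x) x)
    (hle : ∀ x, a < x → f' x ≤ g' x) (hlim : Tendsto (fun x => f x - g x) atTop (𝓝 0))
    {x : ℝ} (hx : a < x) : g x ≤ f x := by
  have hanti : AntitoneOn (fun x => f x - g x) (Ioi a) :=
    antitoneOn_Ioi_of_hasDerivAt_nonpos (fun y hy => (hf y hy).sub (hg y hy))
      fun y hy => sub_nonpos.2 (hle y hy)
  refine sub_nonneg.1 (le_of_tendsto hlim ?_)
  filter_upwards [eventually_ge_atTop x] with y hy using hanti hx (hx.trans_le hy) hy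

theorem exists_eventually_add_le_of_hasDerivAt_le {f g f' g' : ℝ → ℝ}
    (hf : ∀ᶠ x in atTop, HasDerivAt f (f' x) x) (hg : ∀ᶠ x in atTop, HasDerivAt g (g' x) x)
    (hle : ∀ᶠ x in atTop, g' x ≤ f' x) : ∃ C, ∀ᶠ x in atTop, g x + C ≤ f x := by
  obtain ⟨b, hb⟩ := eventually_atTop.1 ((hf.and hg).and hle)
  have hmono : MonotoneOn (fun x => f x - g x) (Ioi b) :=
    monotoneOn_Ioi_of_hasDerivAt_nonneg (fun x hx => (hb x hx.le).1.1.sub (hb x hx.le).1.2)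
      fun x hx => sub_nonneg.2 (hb x hx.le).2
  refine ⟨f (b + 1) - g (b + 1), ?_⟩
  filter_upwards [eventually_ge_atTop (b + 1)] with x hx
  have := hmono (lt_add_one b) ((lt_add_one b).trans_le hx) hx
  linarith

theorem tendsto_atTop_of_div_le_hasDerivAt {f f' : ℝ → ℝ} {c : ℝ} (hc : 0 < c)
    (hf : ∀ᶠ x in atTop, HasDerivAt f (f' x) x) (hle : ∀ᶠ x in atTop, c / x ≤ f' x) :
    Tendsto f atTop atTop := by
  obtain ⟨C, hC⟩ := exists_eventually_add_le_of_hasDerivAt_le (g := fun x => c * Real.log x) hf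
    (by
      filter_upwards [eventually_gt_atTop 0] with x hx
      exact (Real.hasDerivAt_log hx.ne').const_mul c)
    (by simpa only [div_eq_mul_inv] using hle)
  exact tendsto_atTop_mono' _ hC
    (tendsto_atTop_add_const_right _ C (Real.tendsto_log_atTop.const_mul_atTop hc))

theorem exists_tendsto_of_antitoneOn {f : ℝ → ℝ} {a c : ℝ} (hf : AntitoneOn f (Ioi a))
    (hc : ∀ x, a < x → c ≤ f x) :
    ∃ L, c ≤ L ∧ Tendsto f atTop (𝓝 L) ∧ ∀ x, a < x → L ≤ f x := by
  have hmax : ∀ x, a < max x (a + 1) := fun x => lt_max_of_lt_right (lt_add_one a)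
  have hanti : Antitone fun x => f (max x (a + 1)) := fun x y hxy =>
    hf (hmax x) (hmax y) (max_le_max_right _ hxy)
  have hbdd : BddBelow (range fun x => f (max x (a + 1))) :=
    ⟨c, forall_mem_range.2 fun x => hc _ (hmax x)⟩
  have hlim : Tendsto f atTop (𝓝 (⨅ x, f (max x (a + 1)))) := by
    refine (tendsto_atTop_ciInf hanti hbdd).congr' ?_
    filter_upwards [eventually_ge_atTop (a + 1)] with x hx
    rw [max_eq_left hx]
  refine ⟨_, le_ciInf fun x => hc _ (hmax x), hlim, fun x hx => le_of_tendsto hlim ?_⟩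
  filter_upwards [eventually_ge_atTop x] with y hy using hf hx (hx.trans_le hy) hy

theorem exists_forall_le_mul_of_eventually_le {f g : ℝ → ℝ} {ρ C₀ : ℝ}
    (hf : ContinuousOn f (Ici ρ)) (hg : ContinuousOn g (Ici ρ)) (hg0 : ∀ r, ρ ≤ r → 0 < g r)
    (hle : ∀ᶠ r in atTop, f r ≤ C₀ * g r) : ∃ C, 0 < C ∧ ∀ r, ρ ≤ r → f r ≤ C * g r := by
  obtain ⟨R, hR⟩ := eventually_atTop.1 hle
  obtain ⟨M, hM⟩ := isCompact_Icc.bddAbove_image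
    ((hf.div hg fun r hr => (hg0 r hr).ne').mono (Icc_subset_Ici_self : Icc ρ R ⊆ Ici ρ))
  refine ⟨max 1 (max C₀ M), lt_max_of_lt_left one_pos, fun r hr => ?_⟩
  rcases le_total R r with hRr | hrR
  · exact (hR r hRr).trans (mul_le_mul_of_nonneg_right
      ((le_max_left _ _).trans (le_max_right _ _)) (hg0 r hr).le)
  · have hquot : f r / g r ≤ M := hM ⟨r, ⟨hr, hrR⟩, rfl⟩
    rw [← div_le_iff₀ (hg0 r hr)]
    exact hquot.trans ((le_max_right _ _).trans (le_max_right _ _))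

section Equation

variable {d : ℕ} {v w : ℝ → ℝ} {r : ℝ}

/-- The flux `(d - 2) v + r v'` of the radial function `v`. In terms of it the equation
`v'' + ((d - 1) / r) v' = g` reads `flux' = r g`, and `(r ^ (d - 2) v)' = r ^ (d - 3) flux`. -/
noncomputable def flux (d : ℕ) (v : ℝ → ℝ) (r : ℝ) : ℝ :=
  ((d : ℝ) - 2) * v r + r * deriv v r

theorem hasDerivAt_of_flux (hv : DifferentiableAt ℝ v r) (hr : r ≠ 0) :
    HasDerivAt v ((flux d v r - ((d : ℝ) - 2) * v r) / r) r := by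
  refine hv.hasDerivAt.congr_deriv ?_
  rw [flux, add_sub_cancel_left, mul_div_cancel_left₀ _ hr]

theorem flux_sub (hv : DifferentiableAt ℝ v r) (hw : DifferentiableAt ℝ w r) :
    flux d (fun x => v x - w x) r = flux d v r - flux d w r := by
  simp only [flux, deriv_fun_sub hv hw]
  ring

theorem isNonnegSolution_zero (d : ℕ) : IsNonnegSolution d fun _ => 0 where
  contDiffOn := contDiffOn_const
  nonneg _ _ := le_rfl
  ode r _ := by simp

namespace IsNonnegSolution

theorem differentiableAt (hv : IsNonnegSolution d v) (hr : 1 < r) : DifferentiableAt ℝ v r :=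
  (hv.contDiffOn.differentiableOn two_ne_zero).differentiableAt (Ioi_mem_nhds hr)

theorem hasDerivAt_deriv (hv : IsNonnegSolution d v) (hr : 1 < r) :
    HasDerivAt (deriv v) (4 * v r ^ 2 - ((d : ℝ) - 1) / r * deriv v r) r := by
  have hderiv : ContDiffOn ℝ 1 (deriv v) (Ioi 1) :=
    ((contDiffOn_succ_iff_deriv_of_isOpen isOpen_Ioi).1
      (by simpa only [one_add_one_eq_two] using hv.contDiffOn)).2.2
  rw [← hv.ode r hr, add_sub_cancel_right]
  exact ((hderiv.differentiableOn one_ne_zero).differentiableAt (Ioi_mem_nhds hr)).hasDerivAt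

theorem hasDerivAt_flux (hv : IsNonnegSolution d v) (hr : 1 < r) :
    HasDerivAt (flux d v) (4 * r * v r ^ 2) r := by
  have hr0 : r ≠ 0 := by positivity
  refine (((hv.differentiableAt hr).hasDerivAt.const_mul ((d : ℝ) - 2)).add
    ((hasDerivAt_id r).mul (hv.hasDerivAt_deriv hr))).congr_deriv ?_
  simp only [id]
  field_simp
  ring

theorem of_hasDerivAt {h : ℝ → ℝ} (hv0 : ∀ r, 1 < r → 0 ≤ v r)
    (hv : ∀ r, 1 < r → HasDerivAt v ((h r - ((d : ℝ) - 2) * v r) / r) r)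
    (hh : ∀ r, 1 < r → HasDerivAt h (4 * r * v r ^ 2) r) : IsNonnegSolution d v := by
  have hne : ∀ r ∈ Ioi (1 : ℝ), r ≠ 0 := fun r hr => (zero_lt_one.trans hr).ne'
  have hderiv : ∀ r ∈ Ioi (1 : ℝ), deriv v r = (h r - ((d : ℝ) - 2) * v r) / r :=
    fun r hr => (hv r hr).deriv
  have hderiv2 : ∀ r ∈ Ioi (1 : ℝ),
      HasDerivAt (deriv v) (4 * v r ^ 2 - ((d : ℝ) - 1) / r * deriv v r) r := by
    intro r hr
    refine ((((hh r hr).sub ((hv r hr).const_mul ((d : ℝ) - 2))).div (hasDerivAt_id r)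
      (hne r hr)).congr_of_eventuallyEq
        (eventuallyEq_of_mem (Ioi_mem_nhds hr) hderiv)).congr_deriv ?_
    have := hne r hr
    rw [hderiv r hr]
    simp only [id, Pi.sub_apply]
    field_simp
    ring
  have hv_cont : ContinuousOn v (Ioi 1) := fun r hr => (hv r hr).continuousAt.continuousWithinAt
  have hv'_cont : ContinuousOn (deriv v) (Ioi 1) :=
    fun r hr => (hderiv2 r hr).continuousAt.continuousWithinAt
  refine ⟨?_, hv0, fun r hr => by rw [(hderiv2 r hr).deriv, sub_add_cancel]⟩
  rw [← one_add_one_eq_two, contDiffOn_succ_iff_deriv_of_isOpen isOpen_Ioi]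
  refine ⟨fun r hr => (hv r hr).differentiableAt.differentiableWithinAt, by simp, ?_⟩
  rw [← zero_add 1, contDiffOn_succ_iff_deriv_of_isOpen isOpen_Ioi]
  refine ⟨fun r hr => (hderiv2 r hr).differentiableAt.differentiableWithinAt, by simp, ?_⟩
  refine contDiffOn_zero.2 (ContinuousOn.congr ?_ fun r hr => (hderiv2 r hr).deriv)
  fun_prop (disch := assumption)

end IsNonnegSolution

end Equation

section KellerOsserman

variable {d : ℕ} {v w : ℝ → ℝ} {r : ℝ}

theorem hasDerivAt_barrier (A : ℝ) {e z : ℝ} (hz : e ^ 2 - (z - r) ^ 2 ≠ 0) :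
    HasDerivAt (fun z => A / (e ^ 2 - (z - r) ^ 2) ^ 2)
      (4 * A * (z - r) / (e ^ 2 - (z - r) ^ 2) ^ 3) z := by
  have hq := (((hasDerivAt_id z).sub_const r).pow 2).const_sub (e ^ 2)
  refine ((hasDerivAt_const z A).div (hq.pow 2) (pow_ne_zero 2 hz)).congr_deriv ?_
  simp only [id, Pi.pow_apply]
  field_simp
  ring

theorem hasDerivAt_deriv_barrier (A : ℝ) {e z : ℝ} (hz : e ^ 2 - (z - r) ^ 2 ≠ 0) :
    HasDerivAt (fun z => 4 * A * (z - r) / (e ^ 2 - (z - r) ^ 2) ^ 3)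
      (4 * A / (e ^ 2 - (z - r) ^ 2) ^ 3 + 24 * A * (z - r) ^ 2 / (e ^ 2 - (z - r) ^ 2) ^ 4) z := by
  have hq := (((hasDerivAt_id z).sub_const r).pow 2).const_sub (e ^ 2)
  refine ((((hasDerivAt_id z).sub_const r).const_mul (4 * A)).div (hq.pow 3)
    (pow_ne_zero 3 hz)).congr_deriv ?_
  simp only [id, Pi.pow_apply]
  field_simp
  ring

theorem barrier_supersolution (hd : 1 ≤ d) {e z : ℝ} (hr : 0 ≤ r) (hz : 0 < z)
    (hq : 0 < e ^ 2 - (z - r) ^ 2) {A : ℝ} (hA : A = ((d : ℝ) + 6) * e ^ 2) :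
    4 * A / (e ^ 2 - (z - r) ^ 2) ^ 3 + 24 * A * (z - r) ^ 2 / (e ^ 2 - (z - r) ^ 2) ^ 4 +
        ((d : ℝ) - 1) / z * (4 * A * (z - r) / (e ^ 2 - (z - r) ^ 2) ^ 3) ≤
      4 * (A / (e ^ 2 - (z - r) ^ 2) ^ 2) ^ 2 := by
  have hd' : (0 : ℝ) ≤ d - 1 := sub_nonneg.2 (by exact_mod_cast hd)
  have hA0 : 0 ≤ A := by rw [hA]; positivity
  have hratio : (z - r) / z ≤ 1 := (div_le_one hz).2 (by linarith)
  set q := e ^ 2 - (z - r) ^ 2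
  have hbracket : q + 6 * (z - r) ^ 2 + ((d : ℝ) - 1) * ((z - r) / z) * q ≤ A := by
    have hdrift : ((d : ℝ) - 1) * ((z - r) / z) * q ≤ ((d : ℝ) - 1) * 1 * q := by gcongr
    nlinarith [mul_nonneg hd' (sq_nonneg (z - r)), sq_nonneg (z - r)]
  calc _ = 4 * A * (q + 6 * (z - r) ^ 2 + ((d : ℝ) - 1) * ((z - r) / z) * q) / q ^ 4 := by
        field_simp
        ring
    _ ≤ 4 * A * A / q ^ 4 := by gcongr
    _ = 4 * (A / q ^ 2) ^ 2 := by
        field_simp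

/-- The barrier blows up at the ends of `(r - e, r + e)`, so no boundary values of `v` enter. -/
theorem barrier_le_outside_compact {e M A ε : ℝ} (hv : ∀ z ∈ Icc (r - e) (r + e), v z ≤ M)
    (hA : 0 < A) (hε : 0 < ε) :
    ∃ K ⊆ Ioo (r - e) (r + e), IsCompact K ∧ ∀ z ∈ Ioo (r - e) (r + e), z ∉ K →
      -ε ≤ A / (e ^ 2 - (z - r) ^ 2) ^ 2 - v z := by
  refine ⟨{z ∈ Icc (r - e) (r + e) | A ≤ max M 1 * (e ^ 2 - (z - r) ^ 2) ^ 2}, ?_, ?_, ?_⟩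
  · rintro z ⟨hz, hAz⟩
    refine ⟨lt_of_le_of_ne hz.1 ?_, lt_of_le_of_ne hz.2 ?_⟩ <;> rintro rfl <;>
    · ring_nf at hAz
      linarith
  · have hclosed : IsClosed {z | A ≤ max M 1 * (e ^ 2 - (z - r) ^ 2) ^ 2} :=
      isClosed_le continuous_const (by fun_prop)
    exact isCompact_Icc.inter_right hclosed
  · intro z hz hzK
    have hlt : max M 1 * (e ^ 2 - (z - r) ^ 2) ^ 2 < A := by
      by_contra! hle
      exact hzK ⟨Ioo_subset_Icc_self hz, hle⟩
    have hq : 0 < e ^ 2 - (z - r) ^ 2 := by nlinarith [hz.1, hz.2]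
    have hMle : max M 1 ≤ A / (e ^ 2 - (z - r) ^ 2) ^ 2 :=
      (le_div_iff₀ (pow_pos hq 2)).2 hlt.le
    linarith [hv z (Ioo_subset_Icc_self hz), le_max_left M 1]

namespace IsNonnegSolution

theorem le_div_sq (hd : 1 ≤ d) (hv : IsNonnegSolution d v) (hr : 1 < r) :
    v r ≤ 4 * ((d : ℝ) + 6) / (r - 1) ^ 2 := by
  obtain ⟨e, he⟩ : ∃ e, e = (r - 1) / 2 := ⟨_, rfl⟩
  obtain ⟨A, hA⟩ : ∃ A, A = ((d : ℝ) + 6) * e ^ 2 := ⟨_, rfl⟩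
  have he0 : 0 < e := by linarith
  have hgt : ∀ z ∈ Icc (r - e) (r + e), 1 < z := fun z hz => by linarith [hz.1]
  have hq : ∀ z ∈ Ioo (r - e) (r + e), 0 < e ^ 2 - (z - r) ^ 2 := fun z hz => by
    nlinarith [hz.1, hz.2]
  obtain ⟨M, hM⟩ := isCompact_Icc.bddAbove_image (hv.contDiffOn.continuousOn.mono hgt)
  have hcomp : 0 ≤ A / (e ^ 2 - (r - r) ^ 2) ^ 2 - v r := by
    refine nonneg_of_deriv_deriv_add_neg isOpen_Ioo
      (D := fun z => A / (e ^ 2 - (z - r) ^ 2) ^ 2 - v z) (c := fun z => ((d : ℝ) - 1) / z)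
      (fun z hz => (hasDerivAt_barrier A (hq z hz).ne').sub
        (hv.differentiableAt (hgt z (Ioo_subset_Icc_self hz))).hasDerivAt)
      (fun z hz => (hasDerivAt_deriv_barrier A (hq z hz).ne').sub
        (hv.hasDerivAt_deriv (hgt z (Ioo_subset_Icc_self hz))))
      (fun z hz hneg => ?_)
      (fun ε hε => barrier_le_outside_compact (fun z hz => hM (mem_image_of_mem v hz))
        (by rw [hA]; positivity) hε)
      ⟨by linarith, by linarith⟩
    have hz1 := hgt z (Ioo_subset_Icc_self hz)
    have hbarrier := barrier_supersolution hd (by linarith) (by linarith) (hq z hz) hA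
    have hA0 : 0 ≤ A := by rw [hA]; positivity
    have hsq : (A / (e ^ 2 - (z - r) ^ 2) ^ 2) ^ 2 < v z ^ 2 :=
      pow_lt_pow_left₀ (by linarith) (by positivity) two_ne_zero
    simp only [Pi.sub_apply]
    linarith
  have hvalue : A / (e ^ 2 - (r - r) ^ 2) ^ 2 = 4 * ((d : ℝ) + 6) / (r - 1) ^ 2 := by
    have hr1 : r - 1 ≠ 0 := by linarith
    rw [hA, he]
    field_simp
    ring
  linarith

theorem tendsto_mul_zero (hd : 1 ≤ d) (hv : IsNonnegSolution d v) :
    Tendsto (fun r => r * v r) atTop (𝓝 0) := by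
  have hbound : Tendsto (fun r : ℝ => 16 * ((d : ℝ) + 6) / r) atTop (𝓝 0) :=
    tendsto_const_nhds.div_atTop tendsto_id
  refine tendsto_of_tendsto_of_tendsto_of_le_of_le' tendsto_const_nhds hbound ?_ ?_
  · filter_upwards [eventually_gt_atTop 1] with r hr
    exact mul_nonneg (zero_le_one.trans hr.le) (hv.nonneg r hr)
  · filter_upwards [eventually_ge_atTop 2] with r hr
    have hhalf : r / 2 ≤ r - 1 := by linarith
    calc r * v r ≤ r * (4 * ((d : ℝ) + 6) / (r - 1) ^ 2) := by
          gcongr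
          exact hv.le_div_sq hd (by linarith)
      _ ≤ r * (4 * ((d : ℝ) + 6) / (r / 2) ^ 2) := by gcongr
      _ = 16 * ((d : ℝ) + 6) / r := by
          field_simp
          ring

theorem tendsto_zero (hd : 1 ≤ d) (hv : IsNonnegSolution d v) : Tendsto v atTop (𝓝 0) := by
  refine ((hv.tendsto_mul_zero hd).div_atTop tendsto_id).congr' ?_
  filter_upwards [eventually_ne_atTop 0] with r hr using mul_div_cancel_left₀ _ hr

theorem le_of_lt_of_le (hd : 1 ≤ d) (hv : IsNonnegSolution d v) (hw : IsNonnegSolution d w)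
    {a : ℝ} (ha : 1 < a) (hlt : w a < v a) (har : a ≤ r) : w r ≤ v r := by
  rcases har.eq_or_lt with rfl | har
  · exact hlt.le
  have hgt : ∀ x ∈ Ioi a, 1 < x := fun x hx => ha.trans hx
  refine sub_nonneg.1 (nonneg_of_deriv_deriv_add_neg isOpen_Ioi (D := fun x => v x - w x)
    (c := fun x => ((d : ℝ) - 1) / x)
    (fun x hx => (hv.differentiableAt (hgt x hx)).hasDerivAt.sub
      (hw.differentiableAt (hgt x hx)).hasDerivAt)
    (fun x hx => (hv.hasDerivAt_deriv (hgt x hx)).sub (hw.hasDerivAt_deriv (hgt x hx)))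
    (fun x hx hneg => ?_) (fun ε hε => ?_) har)
  · have hsq : v x ^ 2 < w x ^ 2 :=
      pow_lt_pow_left₀ (sub_neg.1 hneg) (hv.nonneg x (hgt x hx)) two_ne_zero
    linarith
  · have hcont : ContinuousAt (fun x => v x - w x) a :=
      (hv.differentiableAt ha).continuousAt.sub (hw.differentiableAt ha).continuousAt
    obtain ⟨b, hab, hb⟩ := exists_Ico_subset_of_mem_nhds
      (hcont.eventually (lt_mem_nhds (sub_pos.2 hlt))) (exists_gt a)
    have hlim : Tendsto (fun x => v x - w x) atTop (𝓝 0) := by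
      simpa using (hv.tendsto_zero hd).sub (hw.tendsto_zero hd)
    obtain ⟨c, hc⟩ := eventually_atTop.1 (hlim.eventually_const_le (neg_lt_zero.2 hε))
    refine ⟨Icc b c, fun x hx => hab.trans_le hx.1, isCompact_Icc, fun x hx hxK => ?_⟩
    rcases lt_or_ge x b with hxb | hbx
    · have hpos : 0 < v x - w x := hb ⟨(mem_Ioi.1 hx).le, hxb⟩
      linarith
    · exact hc x (not_lt.1 fun hxc => hxK ⟨hbx, hxc.le⟩)

theorem le_total (hd : 1 ≤ d) (hv : IsNonnegSolution d v) (hw : IsNonnegSolution d w) :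
    (∀ r, 1 < r → w r ≤ v r) ∨ (∀ r, 1 < r → v r ≤ w r) := by
  by_contra! hcon
  obtain ⟨⟨a, ha, hva⟩, ⟨b, hb, hwb⟩⟩ := hcon
  rcases le_or_gt a b with hab | hba
  · exact absurd (hw.le_of_lt_of_le hd hv ha hva hab) (not_le.2 hwb)
  · exact absurd (hv.le_of_lt_of_le hd hw hb hwb hba.le) (not_le.2 hva)

end IsNonnegSolution

end KellerOsserman

section Comparison

/-- A nonnegative radial function on `(1, ∞)` which is subharmonic in dimension `d` and vanishes at
infinity. Subharmonicity is expressed by the monotonicity of the flux, which makes sense without a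
second derivative. -/
structure IsDecayingSubharmonic (d : ℕ) (v : ℝ → ℝ) : Prop where
  nonneg : ∀ r : ℝ, 1 < r → 0 ≤ v r
  differentiableAt : ∀ r : ℝ, 1 < r → DifferentiableAt ℝ v r
  monotoneOn_flux : MonotoneOn (flux d v) (Ioi 1)
  tendsto_zero : Tendsto v atTop (𝓝 0)

namespace IsDecayingSubharmonic

variable {d k : ℕ} {v : ℝ → ℝ} {r : ℝ}

theorem hasDerivAt (hv : IsDecayingSubharmonic d v) (hr : 1 < r) :
    HasDerivAt v ((flux d v r - ((d : ℝ) - 2) * v r) / r) r :=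
  hasDerivAt_of_flux (hv.differentiableAt r hr) (zero_lt_one.trans hr).ne'

theorem flux_nonpos (hv : IsDecayingSubharmonic d v) (hr : 1 < r) : flux d v r ≤ 0 := by
  by_contra! hpos
  have hzero : Tendsto (fun x => ((d : ℝ) - 2) * v x) atTop (𝓝 0) := by
    simpa using hv.tendsto_zero.const_mul ((d : ℝ) - 2)
  refine not_tendsto_nhds_of_tendsto_atTop (tendsto_atTop_of_div_le_hasDerivAt (half_pos hpos)
    (f' := fun x => (flux d v x - ((d : ℝ) - 2) * v x) / x) ?_ ?_) 0 hv.tendsto_zero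
  · filter_upwards [eventually_gt_atTop 1] with x hx using hv.hasDerivAt hx
  · filter_upwards [eventually_ge_atTop r, hzero.eventually_le_const (half_pos hpos)]
      with x hrx hsmall
    have hx : 1 < x := hr.trans_le hrx
    have hmono := hv.monotoneOn_flux hr hx hrx
    gcongr
    linarith

theorem tendsto_flux (hd : 2 ≤ d) (hv : IsDecayingSubharmonic d v) :
    Tendsto (flux d v) atTop (𝓝 0) := by
  have hd' : (2 : ℝ) ≤ d := by exact_mod_cast hd
  refine tendsto_order.2 ⟨fun c hc => ?_, fun c hc => ?_⟩
  · obtain ⟨r, hr, hrc⟩ : ∃ r, 1 < r ∧ c < flux d v r := by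
      by_contra! hle
      have hneg : Tendsto (fun x => -v x) atTop (𝓝 0) := by simpa using hv.tendsto_zero.neg
      refine not_tendsto_nhds_of_tendsto_atTop (tendsto_atTop_of_div_le_hasDerivAt (neg_pos.2 hc)
        (f' := fun x => -((flux d v x - ((d : ℝ) - 2) * v x) / x)) ?_ ?_) 0 hneg
      · filter_upwards [eventually_gt_atTop 1] with x hx using (hv.hasDerivAt hx).neg
      · filter_upwards [eventually_gt_atTop 1] with x hx
        have := hle x hx
        have := mul_nonneg (sub_nonneg.2 hd') (hv.nonneg x hx)
        rw [← neg_div]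
        gcongr
        linarith
    filter_upwards [eventually_ge_atTop r] with x hx
    exact hrc.trans_le (hv.monotoneOn_flux hr (hr.trans_le hx) hx)
  · filter_upwards [eventually_gt_atTop 1] with x hx using (hv.flux_nonpos hx).trans_lt hc

theorem antitoneOn (hd : 2 ≤ d) (hv : IsDecayingSubharmonic d v) : AntitoneOn v (Ioi 1) := by
  have hd' : (2 : ℝ) ≤ d := by exact_mod_cast hd
  refine antitoneOn_Ioi_of_hasDerivAt_nonpos (fun x hx => hv.hasDerivAt hx) fun x hx => ?_
  have := mul_nonneg (sub_nonneg.2 hd') (hv.nonneg x hx)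
  exact div_nonpos_of_nonpos_of_nonneg (by linarith [hv.flux_nonpos hx]) (by linarith)

theorem hasDerivAt_pow_mul (hv : IsDecayingSubharmonic (k + 2) v) (hr : 1 < r) :
    HasDerivAt (fun r => r ^ k * v r) (r ^ k * flux (k + 2) v r / r) r := by
  have hr0 : r ≠ 0 := by positivity
  refine ((hasDerivAt_pow k r).mul (hv.hasDerivAt hr)).congr_deriv ?_
  rcases k with _ | k
  · simp
  · push_cast
    rw [add_tsub_cancel_right]
    field_simp
    ring

theorem antitoneOn_pow_mul (hv : IsDecayingSubharmonic (k + 2) v) :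
    AntitoneOn (fun r => r ^ k * v r) (Ioi 1) := by
  refine antitoneOn_Ioi_of_hasDerivAt_nonpos (fun x hx => hv.hasDerivAt_pow_mul hx) fun x hx => ?_
  have hx0 : 0 < x := zero_lt_one.trans hx
  exact div_nonpos_of_nonpos_of_nonneg
    (mul_nonpos_of_nonneg_of_nonpos (by positivity) (hv.flux_nonpos hx)) hx0.le

theorem neg_flux_le (hd : 2 ≤ d) (hv : IsDecayingSubharmonic d v) {a b : ℝ} (ha : 1 < a)
    (hab : a < b) (hbr : b ≤ r) : -flux d v r ≤ b / (b - a) * v a := by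
  have hd' : (2 : ℝ) ≤ d := by exact_mod_cast hd
  obtain ⟨x, hx, hslope⟩ := exists_hasDerivAt_eq_slope v
    (fun r => (flux d v r - ((d : ℝ) - 2) * v r) / r) hab
    (fun y hy => (hv.differentiableAt y (ha.trans_le hy.1)).continuousAt.continuousWithinAt)
    (fun y hy => hv.hasDerivAt (ha.trans hy.1))
  have hx1 : 1 < x := ha.trans hx.1
  have hx0 : 0 < x := zero_lt_one.trans hx1
  have hflux : flux d v x ≤ flux d v r :=
    hv.monotoneOn_flux hx1 (hx1.trans (hx.2.trans_le hbr)) (hx.2.le.trans hbr)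
  have hvx := mul_nonneg (sub_nonneg.2 hd') (hv.nonneg x hx1)
  have hvb : 0 ≤ v b := hv.nonneg b (ha.trans hab)
  have hvab : v b ≤ v a := hv.antitoneOn hd ha (ha.trans hab) hab.le
  have hba : 0 < b - a := sub_pos.2 hab
  rw [div_eq_iff hx0.ne'] at hslope
  calc -flux d v r ≤ (v a - v b) / (b - a) * x := by
        rw [← neg_sub (v b), neg_div, neg_mul]
        linarith
    _ ≤ v a / (b - a) * b := by
        have := hx.2.le
        have := hv.nonneg a ha
        gcongr
        linarith
    _ = b / (b - a) * v a := by ring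

end IsDecayingSubharmonic

namespace IsNonnegSolution

variable {d : ℕ} {v w : ℝ → ℝ} {a b r : ℝ}

theorem isDecayingSubharmonic_sub (hd : 1 ≤ d) (hv : IsNonnegSolution d v)
    (hw : IsNonnegSolution d w) (hle : ∀ r, 1 < r → w r ≤ v r) :
    IsDecayingSubharmonic d fun r => v r - w r where
  nonneg r hr := sub_nonneg.2 (hle r hr)
  differentiableAt r hr := (hv.differentiableAt hr).sub (hw.differentiableAt hr)
  monotoneOn_flux := by
    refine (monotoneOn_Ioi_of_hasDerivAt_nonneg
      (fun x hx => (hv.hasDerivAt_flux hx).sub (hw.hasDerivAt_flux hx)) fun x hx => ?_).congr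
      fun x hx => (flux_sub (hv.differentiableAt hx) (hw.differentiableAt hx)).symm
    have hsq : w x ^ 2 ≤ v x ^ 2 := pow_le_pow_left₀ (hw.nonneg x hx) (hle x hx) 2
    rw [sub_nonneg]
    gcongr
  tendsto_zero := by simpa using (hv.tendsto_zero hd).sub (hw.tendsto_zero hd)

theorem isDecayingSubharmonic (hd : 1 ≤ d) (hv : IsNonnegSolution d v) :
    IsDecayingSubharmonic d v := by
  simpa only [sub_zero] using hv.isDecayingSubharmonic_sub hd (isNonnegSolution_zero d) hv.nonneg

theorem abs_sub_le (hd : 2 ≤ d) (hv : IsNonnegSolution d v) (hw : IsNonnegSolution d w)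
    (ha : 1 < a) (har : a ≤ r) : |v r - w r| ≤ |v a - w a| := by
  have hd1 : 1 ≤ d := by omega
  wlog hle : ∀ r, 1 < r → w r ≤ v r generalizing v w
  · rw [abs_sub_comm, abs_sub_comm (v a)]
    exact this hw hv ((hv.le_total hd1 hw).resolve_left hle)
  have hsub := hv.isDecayingSubharmonic_sub hd1 hw hle
  rw [abs_of_nonneg (hsub.nonneg r (ha.trans_le har)), abs_of_nonneg (hsub.nonneg a ha)]
  exact hsub.antitoneOn hd ha (ha.trans_le har) har

theorem abs_flux_sub_le (hd : 2 ≤ d) (hv : IsNonnegSolution d v) (hw : IsNonnegSolution d w)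
    (ha : 1 < a) (hab : a < b) (hbr : b ≤ r) :
    |flux d v r - flux d w r| ≤ b / (b - a) * |v a - w a| := by
  have hd1 : 1 ≤ d := by omega
  have hr : 1 < r := ha.trans (hab.trans_le hbr)
  wlog hle : ∀ r, 1 < r → w r ≤ v r generalizing v w
  · rw [abs_sub_comm, abs_sub_comm (v a)]
    exact this hw hv ((hv.le_total hd1 hw).resolve_left hle)
  have hsub := hv.isDecayingSubharmonic_sub hd1 hw hle
  have hflux := flux_sub (d := d) (hv.differentiableAt hr) (hw.differentiableAt hr)
  rw [← hflux, abs_of_nonpos (hsub.flux_nonpos hr), abs_of_nonneg (hsub.nonneg a ha)]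
  exact hsub.neg_flux_le hd ha hab hbr

end IsNonnegSolution

end Comparison

theorem exists_tendstoLocallyUniformlyOn_of_dist_le {X : Type*} [TopologicalSpace X] {s : Set X}
    {f : ℕ → X → ℝ} (hf : ∀ x ∈ s, ∃ t ∈ 𝓝[s] x, ∃ σ : ℕ → ℝ, CauchySeq σ ∧
      ∀ y ∈ t, ∀ m n, dist (f m y) (f n y) ≤ dist (σ m) (σ n)) :
    ∃ g : X → ℝ, TendstoLocallyUniformlyOn f g atTop s := by
  have hlim : ∀ x, ∃ L, x ∈ s → Tendsto (fun n => f n x) atTop (𝓝 L) := by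
    intro x
    by_cases hx : x ∈ s
    · obtain ⟨t, ht, σ, hσ, hft⟩ := hf x hx
      obtain ⟨L, hL⟩ := cauchySeq_tendsto_of_complete (u := fun n => f n x) <| by
        rw [Metric.cauchySeq_iff] at hσ ⊢
        refine fun ε hε => (hσ ε hε).imp fun N hN m hm n hn => ?_
        exact (hft x (mem_of_mem_nhdsWithin hx ht) m n).trans_lt (hN m hm n hn)
      exact ⟨L, fun _ => hL⟩
    · exact ⟨0, fun h => absurd h hx⟩
  choose g hg using hlim
  refine ⟨g, tendstoLocallyUniformlyOn_of_forall_exists_nhds fun x hx => ?_⟩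
  obtain ⟨t, ht, σ, hσ, hft⟩ := hf x hx
  refine ⟨t ∩ s, inter_mem ht self_mem_nhdsWithin,
    UniformCauchySeqOn.tendstoUniformlyOn_of_tendsto ?_ fun y hy => hg y hy.2⟩
  rw [Metric.cauchySeq_iff] at hσ
  refine Metric.uniformCauchySeqOn_iff.2 fun ε hε => (hσ ε hε).imp fun N hN m hm n hn y hy => ?_
  exact (hft y hy.1 m n).trans_lt (hN m hm n hn)

section Limits

variable {d : ℕ} {V : ℕ → ℝ → ℝ} {u : ℝ → ℝ}

theorem IsNonnegSolution.tendstoLocallyUniformlyOn (hd : 2 ≤ d) (hV : ∀ n, IsNonnegSolution d (V n))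
    (hlim : ∀ r, 1 < r → Tendsto (fun n => V n r) atTop (𝓝 (u r))) :
    TendstoLocallyUniformlyOn V u atTop (Ioi 1) := by
  obtain ⟨g, hg⟩ : ∃ g, TendstoLocallyUniformlyOn V g atTop (Ioi 1) := by
    refine exists_tendstoLocallyUniformlyOn_of_dist_le fun x hx => ?_
    obtain ⟨a, ha, hax⟩ := exists_between (mem_Ioi.1 hx)
    exact ⟨Ioi a, mem_nhdsWithin_of_mem_nhds (Ioi_mem_nhds hax), _, (hlim a ha).cauchySeq,
      fun y hy m n => (hV m).abs_sub_le hd (hV n) ha (mem_Ioi.1 hy).le⟩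
  exact hg.congr_right fun r hr => tendsto_nhds_unique (hg.tendsto_at hr) (hlim r hr)

theorem IsNonnegSolution.exists_tendstoLocallyUniformlyOn_flux (hd : 2 ≤ d)
    (hV : ∀ n, IsNonnegSolution d (V n))
    (hlim : ∀ r, 1 < r → Tendsto (fun n => V n r) atTop (𝓝 (u r))) :
    ∃ h, TendstoLocallyUniformlyOn (fun n => flux d (V n)) h atTop (Ioi 1) := by
  refine exists_tendstoLocallyUniformlyOn_of_dist_le fun x hx => ?_
  obtain ⟨b, hb, hbx⟩ := exists_between (mem_Ioi.1 hx)
  obtain ⟨a, ha, hab⟩ := exists_between hb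
  refine ⟨Ioi b, mem_nhdsWithin_of_mem_nhds (Ioi_mem_nhds hbx), _,
    ((hlim a ha).const_mul (b / (b - a))).cauchySeq, fun y hy m n => ?_⟩
  rw [Real.dist_eq, Real.dist_eq, ← mul_sub, abs_mul,
    abs_of_pos (div_pos (by linarith) (sub_pos.2 hab))]
  exact (hV m).abs_flux_sub_le hd (hV n) ha hab (mem_Ioi.1 hy).le

theorem IsNonnegSolution.of_tendsto (hd : 2 ≤ d) (hV : ∀ n, IsNonnegSolution d (V n))
    (hlim : ∀ r, 1 < r → Tendsto (fun n => V n r) atTop (𝓝 (u r))) : IsNonnegSolution d u := by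
  have hVu := IsNonnegSolution.tendstoLocallyUniformlyOn hd hV hlim
  obtain ⟨h, hVh⟩ := IsNonnegSolution.exists_tendstoLocallyUniformlyOn_flux hd hV hlim
  have hconst : ∀ φ : ℝ → ℝ, TendstoLocallyUniformlyOn (fun _ : ℕ => φ) φ atTop (Ioi 1) :=
    fun φ U hU x _ => ⟨univ, univ_mem, .of_forall fun _ _ _ => refl_mem_uniformity hU⟩
  have hu_cont : ContinuousOn u (Ioi 1) := hVu.continuousOn <| .of_forall fun n =>
    (hV n).contDiffOn.continuousOn
  have hh_cont : ContinuousOn h (Ioi 1) := hVh.continuousOn <| .of_forall fun n r hr =>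
    ((hV n).hasDerivAt_flux hr).continuousAt.continuousWithinAt
  have hderiv_lim : TendstoLocallyUniformlyOn
      (fun n r => (flux d (V n) r - ((d : ℝ) - 2) * V n r) / r)
      (fun r => (h r - ((d : ℝ) - 2) * u r) / r) atTop (Ioi 1) :=
    (hVh.fun_sub
      ((hconst fun _ => (d : ℝ) - 2).fun_mul₀ hVu continuousOn_const hu_cont)).fun_div₀
      (hconst id) (by fun_prop) continuousOn_id fun x hx => (zero_lt_one.trans hx).ne'
  have hsource_lim : TendstoLocallyUniformlyOn (fun n r => 4 * r * V n r ^ 2)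
      (fun r => 4 * r * u r ^ 2) atTop (Ioi 1) := by
    simpa only [sq] using (hconst fun x => 4 * x).fun_mul₀ (hVu.fun_mul₀ hVu hu_cont hu_cont)
      (by fun_prop) (by fun_prop)
  refine .of_hasDerivAt (h := h)
    (fun r hr => ge_of_tendsto' (hlim r hr) fun n => (hV n).nonneg r hr)
    (fun r hr => (hasDerivAt_of_tendstoLocallyUniformlyOn isOpen_Ioi hderiv_lim
      (.of_forall fun n x hx => hasDerivAt_of_flux ((hV n).differentiableAt hx)
        (zero_lt_one.trans hx).ne') hlim hr :))
    fun r hr => hasDerivAt_of_tendstoLocallyUniformlyOn isOpen_Ioi hsource_lim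
      (.of_forall fun n x hx => (hV n).hasDerivAt_flux hx) (fun x hx => hVh.tendsto_at hx) hr

end Limits

section Supremum

variable {d : ℕ}

/-- The pointwise supremum of all nonnegative solutions, the candidate for the maximal one. It is
meaningful on `(1, ∞)`, where the family is bounded by the Keller–Osserman estimate. -/
noncomputable def supNonnegSolution (d : ℕ) (r : ℝ) : ℝ :=
  ⨆ v : {v : ℝ → ℝ // IsNonnegSolution d v}, v.1 r

theorem IsNonnegSolution.le_supNonnegSolution (hd : 1 ≤ d) {v : ℝ → ℝ}
    (hv : IsNonnegSolution d v) {r : ℝ} (hr : 1 < r) : v r ≤ supNonnegSolution d r :=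
  le_ciSup (f := fun v : {v : ℝ → ℝ // IsNonnegSolution d v} => v.1 r)
    ⟨_, forall_mem_range.2 fun v => v.2.le_div_sq hd hr⟩ ⟨v, hv⟩

theorem supNonnegSolution_le {r C : ℝ} (h : ∀ v, IsNonnegSolution d v → v r ≤ C) :
    supNonnegSolution d r ≤ C :=
  have : Nonempty {v : ℝ → ℝ // IsNonnegSolution d v} := ⟨⟨_, isNonnegSolution_zero d⟩⟩
  ciSup_le fun v => h v.1 v.2

theorem IsNonnegSolution.supNonnegSolution_sub_le (hd : 2 ≤ d) {v : ℝ → ℝ}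
    (hv : IsNonnegSolution d v) {a r : ℝ} (ha : 1 < a) (har : a ≤ r) :
    supNonnegSolution d r - v r ≤ supNonnegSolution d a - v a := by
  have hd1 : 1 ≤ d := by omega
  rw [sub_le_iff_le_add]
  refine supNonnegSolution_le fun w hw => ?_
  have hsup := hv.le_supNonnegSolution hd1 ha
  rcases hw.le_total hd1 hv with hvw | hwv
  · have := (hw.isDecayingSubharmonic_sub hd1 hv hvw).antitoneOn hd ha (ha.trans_le har) har
    linarith [hw.le_supNonnegSolution hd1 ha]
  · linarith [hwv r (ha.trans_le har)]

theorem exists_seq_tendsto_supNonnegSolution (hd : 2 ≤ d) :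
    ∃ V : ℕ → ℝ → ℝ, (∀ n, IsNonnegSolution d (V n)) ∧
      ∀ r, 1 < r → Tendsto (fun n => V n r) atTop (𝓝 (supNonnegSolution d r)) := by
  have hd1 : 1 ≤ d := by omega
  obtain ⟨ε, hε⟩ : ∃ ε : ℕ → ℝ, ε = fun n : ℕ => 1 / ((n : ℝ) + 1) := ⟨_, rfl⟩
  have hε_pos : ∀ n, 0 < ε n := fun n => by rw [hε]; positivity
  have hε_lim : Tendsto ε atTop (𝓝 0) := by
    rw [hε]
    exact tendsto_one_div_add_atTop_nhds_zero_nat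
  have hex : ∀ n, ∃ v, IsNonnegSolution d v ∧
      supNonnegSolution d (1 + ε n) - ε n < v (1 + ε n) := by
    by_contra! hle
    obtain ⟨n, hn⟩ := hle
    linarith [supNonnegSolution_le hn, hε_pos n]
  choose V hV hV_lt using hex
  refine ⟨V, hV, fun r hr => tendsto_of_tendsto_of_tendsto_of_le_of_le'
    (by simpa using hε_lim.const_sub (supNonnegSolution d r)) tendsto_const_nhds ?_
    (.of_forall fun n => (hV n).le_supNonnegSolution hd1 hr)⟩
  filter_upwards [hε_lim.eventually_lt_const (sub_pos.2 hr)] with n hn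
  have := (hV n).supNonnegSolution_sub_le hd (lt_add_of_pos_right 1 (hε_pos n))
    (by linarith : 1 + ε n ≤ r)
  linarith [hV_lt n]

theorem exists_isMaximalNonnegSolution (hd : 2 ≤ d) : ∃ u, IsMaximalNonnegSolution d u := by
  obtain ⟨V, hV, hlim⟩ := exists_seq_tendsto_supNonnegSolution hd
  exact ⟨_, .of_tendsto hd hV hlim, fun v hv r hr => hv.le_supNonnegSolution (by omega) hr⟩

theorem IsMaximalNonnegSolution.eq {u v : ℝ → ℝ} (hu : IsMaximalNonnegSolution d u)
    (hv : IsMaximalNonnegSolution d v) {r : ℝ} (hr : 1 < r) : u r = v r :=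
  le_antisymm (hv.le_of_isNonnegSolution u hu.isNonnegSolution r hr)
    (hu.le_of_isNonnegSolution v hv.isNonnegSolution r hr)

end Supremum

section Green

open MeasureTheory

variable {d : ℕ} {u w : ℝ → ℝ} {B r s x : ℝ}

/-- The source `2 d u / x ^ 3 - 4 u ^ 2 / x`. The equation for `u` says that `-greenSource d u` is
the derivative of `ζ`, where `(r ^ d u)' = r ^ (d + 1) ζ`. The linear term makes the source
increasing in `u` as long as `0 ≤ u ≤ 1 / x ^ 2`. -/
noncomputable def greenSource (d : ℕ) (u : ℝ → ℝ) (x : ℝ) : ℝ :=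
  2 * d * u x / x ^ 3 - 4 * u x ^ 2 / x

/-- The integral of the source from infinity. -/
noncomputable def greenInner (d : ℕ) (u : ℝ → ℝ) (s : ℝ) : ℝ :=
  ∫ x in Ioi s, greenSource d u x

/-- The integral operator whose fixed points are the solutions with `u 1 = B`. It preserves the
order of functions between `0` and `1 / r ^ 2`. -/
noncomputable def greenOp (d : ℕ) (B : ℝ) (u : ℝ → ℝ) (r : ℝ) : ℝ :=
  (B + ∫ s in (1 : ℝ)..r, s ^ (d + 1) * greenInner d u s) / r ^ d

/-- The functions on which the Green operator acts. The monotonicity condition passes to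
suprema, and it makes admissible functions measurable. -/
structure IsAdmissible (d : ℕ) (u : ℝ → ℝ) : Prop where
  monotoneOn : MonotoneOn (fun r => r ^ d * u r) (Ici 1)
  nonneg : ∀ r : ℝ, 1 ≤ r → 0 ≤ u r
  le : ∀ r : ℝ, 1 ≤ r → u r ≤ 1 / r ^ 2

theorem greenSource_le_greenSource (hd : 4 ≤ d) (hx : 0 < x) (huw : u x ≤ w x)
    (hw : w x ≤ 1 / x ^ 2) : greenSource d u x ≤ greenSource d w x := by
  have hd' : (4 : ℝ) ≤ d := by exact_mod_cast hd
  have hdiff : greenSource d w x - greenSource d u x =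
      (w x - u x) / x * (2 * d * (1 / x ^ 2) - 4 * (w x + u x)) := by
    rw [greenSource, greenSource]
    field_simp
    ring
  have hslope : 0 ≤ 2 * d * (1 / x ^ 2) - 4 * (w x + u x) := by
    have : 0 ≤ 1 / x ^ 2 := by positivity
    nlinarith
  rw [← sub_nonneg, hdiff]
  exact mul_nonneg (div_nonneg (sub_nonneg.2 huw) hx.le) hslope

theorem greenSource_le (hd : 4 ≤ d) (hx : 0 < x) (hu : u x ≤ 1 / x ^ 2) :
    greenSource d u x ≤ (2 * d - 4) * x ^ (-5 : ℝ) := by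
  refine (greenSource_le_greenSource hd (w := fun x => 1 / x ^ 2) hx hu le_rfl).trans_eq ?_
  rw [greenSource, Real.rpow_neg hx.le, show (5 : ℝ) = ((5 : ℕ) : ℝ) by norm_num,
    Real.rpow_natCast]
  field_simp

theorem pow_mul_greenOp (d : ℕ) (B : ℝ) (u : ℝ → ℝ) (hr : r ≠ 0) :
    r ^ d * greenOp d B u r = B + ∫ s in (1 : ℝ)..r, s ^ (d + 1) * greenInner d u s :=
  mul_div_cancel₀ _ (pow_ne_zero d hr)

namespace IsAdmissible

theorem greenSource_nonneg (hd : 4 ≤ d) (hu : IsAdmissible d u) (hx : 1 ≤ x) :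
    0 ≤ greenSource d u x := by
  simpa [greenSource] using greenSource_le_greenSource hd (u := fun _ => 0)
    (zero_lt_one.trans_le hx) (hu.nonneg x hx) (hu.le x hx)

theorem aemeasurable (hu : IsAdmissible d u) : AEMeasurable u (volume.restrict (Ioi 1)) := by
  have hmul : AEMeasurable (fun r => r ^ d * u r) (volume.restrict (Ioi (1 : ℝ))) :=
    (aemeasurable_restrict_of_monotoneOn measurableSet_Ici hu.monotoneOn).mono_measure
      (Measure.restrict_mono Ioi_subset_Ici_self le_rfl)
  refine (hmul.div (measurable_id.pow_const d).aemeasurable).congr ?_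
  filter_upwards [ae_restrict_mem measurableSet_Ioi] with x hx
  exact mul_div_cancel_left₀ _ (pow_ne_zero d (zero_lt_one.trans hx).ne')

theorem integrableOn_greenSource (hd : 4 ≤ d) (hu : IsAdmissible d u) (hs : 1 ≤ s) :
    IntegrableOn (greenSource d u) (Ioi s) := by
  have hmeas : AEStronglyMeasurable (greenSource d u) (volume.restrict (Ioi 1)) := by
    have := hu.aemeasurable
    unfold greenSource
    exact AEMeasurable.aestronglyMeasurable (by fun_prop)
  refine IntegrableOn.mono_set (Integrable.mono' (g := fun x => (2 * d - 4) * x ^ (-5 : ℝ))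
    ((integrableOn_Ioi_rpow_of_lt (by norm_num) one_pos).const_mul _) hmeas ?_)
    (Ioi_subset_Ioi hs)
  filter_upwards [ae_restrict_mem measurableSet_Ioi] with x hx
  rw [Real.norm_of_nonneg (hu.greenSource_nonneg hd (mem_Ioi.1 hx).le)]
  exact greenSource_le hd (zero_lt_one.trans hx) (hu.le x (mem_Ioi.1 hx).le)

theorem greenInner_nonneg (hd : 4 ≤ d) (hu : IsAdmissible d u) (hs : 1 ≤ s) :
    0 ≤ greenInner d u s :=
  setIntegral_nonneg measurableSet_Ioi fun _ hx => hu.greenSource_nonneg hd (hs.trans_lt hx).le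

theorem greenInner_le (hd : 4 ≤ d) (hu : IsAdmissible d u) (hs : 1 ≤ s) :
    greenInner d u s ≤ ((d : ℝ) - 2) / 2 / s ^ 4 := by
  have hs0 : 0 < s := zero_lt_one.trans_le hs
  calc greenInner d u s ≤ ∫ x in Ioi s, (2 * d - 4) * x ^ (-5 : ℝ) := by
        refine setIntegral_mono_on (hu.integrableOn_greenSource hd hs)
          ((integrableOn_Ioi_rpow_of_lt (by norm_num) hs0).const_mul _) measurableSet_Ioi
          fun x hx => greenSource_le hd (hs0.trans hx) (hu.le x (hs.trans_lt hx).le)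
    _ = ((d : ℝ) - 2) / 2 / s ^ 4 := by
        rw [integral_const_mul, integral_Ioi_rpow_of_lt (by norm_num) hs0,
          show (-5 : ℝ) + 1 = -((4 : ℕ) : ℝ) by norm_num, Real.rpow_neg hs0.le,
          Real.rpow_natCast]
        push_cast
        field_simp
        ring

theorem tendsto_greenInner (hd : 4 ≤ d) (hu : IsAdmissible d u) :
    Tendsto (greenInner d u) atTop (𝓝 0) := by
  have hbound : Tendsto (fun s : ℝ => ((d : ℝ) - 2) / 2 / s ^ 4) atTop (𝓝 0) :=
    tendsto_const_nhds.div_atTop (tendsto_pow_atTop four_ne_zero)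
  refine tendsto_of_tendsto_of_tendsto_of_le_of_le' tendsto_const_nhds hbound ?_ ?_
  · filter_upwards [eventually_ge_atTop 1] with s hs using hu.greenInner_nonneg hd hs
  · filter_upwards [eventually_ge_atTop 1] with s hs using hu.greenInner_le hd hs

theorem greenInner_mono (hd : 4 ≤ d) (hu : IsAdmissible d u) (hw : IsAdmissible d w)
    (huw : ∀ r, 1 ≤ r → u r ≤ w r) (hs : 1 ≤ s) : greenInner d u s ≤ greenInner d w s :=
  setIntegral_mono_on (hu.integrableOn_greenSource hd hs) (hw.integrableOn_greenSource hd hs)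
    measurableSet_Ioi fun x hx =>
      have hx1 : 1 ≤ x := (hs.trans_lt hx).le
      greenSource_le_greenSource hd (zero_lt_one.trans_le hx1) (huw x hx1) (hw.le x hx1)

theorem greenInner_eq_sub (hd : 4 ≤ d) (hu : IsAdmissible d u) (hs : 1 ≤ s) :
    greenInner d u s = greenInner d u 1 - ∫ x in (1 : ℝ)..s, greenSource d u x := by
  rw [← intervalIntegral.integral_Ioi_sub_Ioi (hu.integrableOn_greenSource hd le_rfl) hs,
    greenInner, greenInner, sub_sub_cancel]

theorem intervalIntegrable_greenSource (hd : 4 ≤ d) (hu : IsAdmissible d u) (hs : 1 ≤ s) :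
    IntervalIntegrable (greenSource d u) volume 1 s := by
  rw [intervalIntegrable_iff_integrableOn_Ioc_of_le hs]
  exact (hu.integrableOn_greenSource hd le_rfl).mono_set Ioc_subset_Ioi_self

theorem continuousOn_greenInner (hd : 4 ≤ d) (hu : IsAdmissible d u) (R : ℝ) :
    ContinuousOn (greenInner d u) (Icc 1 R) := by
  rcases lt_or_ge R 1 with hR | hR
  · simp [Icc_eq_empty (not_le.2 hR)]
  have hprim := intervalIntegral.continuousOn_primitive_interval'
    (hu.intervalIntegrable_greenSource hd hR) (a := 1) (by simp)
  rw [uIcc_of_le hR] at hprim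
  exact (continuousOn_const.sub hprim).congr fun s hs => hu.greenInner_eq_sub hd hs.1

theorem continuousOn_pow_mul_greenInner (hd : 4 ≤ d) (hu : IsAdmissible d u) (R : ℝ) :
    ContinuousOn (fun s => s ^ (d + 1) * greenInner d u s) (Icc 1 R) :=
  (continuousOn_pow (d + 1)).mul (hu.continuousOn_greenInner hd R)

theorem intervalIntegrable_pow_mul_greenInner (hd : 4 ≤ d) (hu : IsAdmissible d u) {a b : ℝ}
    (ha : 1 ≤ a) (hab : a ≤ b) :
    IntervalIntegrable (fun s => s ^ (d + 1) * greenInner d u s) volume a b := by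
  refine ContinuousOn.intervalIntegrable ?_
  rw [uIcc_of_le hab]
  exact (hu.continuousOn_pow_mul_greenInner hd b).mono (Icc_subset_Icc_left ha)

theorem hasDerivAt_greenInner (hd : 4 ≤ d) (hu : IsAdmissible d u)
    (hcont : ContinuousOn u (Ioi 1)) (hr : 1 < r) :
    HasDerivAt (greenInner d u) (-greenSource d u r) r := by
  have hsource : ContinuousOn (greenSource d u) (Ioi 1) := by
    have hne : ∀ r ∈ Ioi (1 : ℝ), r ≠ 0 := fun r hr => (zero_lt_one.trans hr).ne'
    have hne3 : ∀ r ∈ Ioi (1 : ℝ), r ^ 3 ≠ 0 := fun r hr => pow_ne_zero 3 (hne r hr)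
    unfold greenSource
    fun_prop (disch := assumption)
  refine ((intervalIntegral.integral_hasDerivAt_right
    (hu.intervalIntegrable_greenSource hd hr.le)
    (hsource.stronglyMeasurableAtFilter isOpen_Ioi r hr)
    (hsource.continuousAt (Ioi_mem_nhds hr))).const_sub (greenInner d u 1)).congr_of_eventuallyEq ?_
  filter_upwards [Ioi_mem_nhds hr] with s hs using hu.greenInner_eq_sub hd (mem_Ioi.1 hs).le

theorem hasDerivAt_integral_pow_mul_greenInner (hd : 4 ≤ d) (hu : IsAdmissible d u) (hr : 1 < r) :
    HasDerivAt (fun r => ∫ s in (1 : ℝ)..r, s ^ (d + 1) * greenInner d u s)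
      (r ^ (d + 1) * greenInner d u r) r := by
  have hcont := (hu.continuousOn_pow_mul_greenInner hd (r + 1)).mono Ioo_subset_Icc_self
  have hmem : r ∈ Ioo 1 (r + 1) := ⟨hr, lt_add_one r⟩
  exact intervalIntegral.integral_hasDerivAt_right
    (hu.intervalIntegrable_pow_mul_greenInner hd le_rfl hr.le)
    (hcont.stronglyMeasurableAtFilter isOpen_Ioo r hmem)
    (hcont.continuousAt (isOpen_Ioo.mem_nhds hmem))

theorem greenOp_mono (hd : 4 ≤ d) (B : ℝ) (hu : IsAdmissible d u) (hw : IsAdmissible d w)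
    (huw : ∀ r, 1 ≤ r → u r ≤ w r) (hr : 1 ≤ r) : greenOp d B u r ≤ greenOp d B w r := by
  unfold greenOp
  gcongr
  refine intervalIntegral.integral_mono_on hr
    (hu.intervalIntegrable_pow_mul_greenInner hd le_rfl hr)
    (hw.intervalIntegrable_pow_mul_greenInner hd le_rfl hr) fun s hs => ?_
  exact mul_le_mul_of_nonneg_left (hu.greenInner_mono hd hw huw hs.1)
    (pow_nonneg (zero_le_one.trans hs.1) _)

theorem integral_pow_mul_greenInner_le (hd : 4 ≤ d) (hu : IsAdmissible d u) (hr : 1 ≤ r) :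
    ∫ s in (1 : ℝ)..r, s ^ (d + 1) * greenInner d u s ≤ (r ^ (d - 2) - 1) / 2 := by
  obtain ⟨k, rfl⟩ : ∃ k, d = k + 4 := ⟨d - 4, by omega⟩
  calc ∫ s in (1 : ℝ)..r, s ^ (k + 4 + 1) * greenInner (k + 4) u s
      ≤ ∫ s in (1 : ℝ)..r, ((k : ℝ) + 2) / 2 * s ^ (k + 1) := by
        refine intervalIntegral.integral_mono_on hr
          (hu.intervalIntegrable_pow_mul_greenInner hd le_rfl hr)
          (Continuous.intervalIntegrable (by fun_prop) _ _) fun s hs => ?_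
        have hs0 : 0 < s := zero_lt_one.trans_le hs.1
        calc s ^ (k + 4 + 1) * greenInner (k + 4) u s
            ≤ s ^ (k + 4 + 1) * ((((k + 4 : ℕ) : ℝ) - 2) / 2 / s ^ 4) := by
              gcongr
              exact hu.greenInner_le hd hs.1
          _ = ((k : ℝ) + 2) / 2 * s ^ (k + 1) := by
              push_cast
              field_simp
              ring
    _ = (r ^ (k + 4 - 2) - 1) / 2 := by
        rw [intervalIntegral.integral_const_mul, integral_pow, one_pow,
          show k + 4 - 2 = k + 1 + 1 by omega]
        push_cast
        field_simp
        ring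

theorem greenOp_le (hd : 4 ≤ d) (hB : B ≤ 1) (hu : IsAdmissible d u) (hr : 1 ≤ r) :
    greenOp d B u r ≤ 1 / r ^ 2 := by
  have hpow : r ^ d = r ^ (d - 2) * r ^ 2 := by rw [← pow_add]; congr 1; omega
  have hone : 1 ≤ r ^ (d - 2) := one_le_pow₀ hr
  rw [greenOp, div_le_div_iff₀ (by positivity) (by positivity), one_mul, hpow]
  gcongr
  linarith [hu.integral_pow_mul_greenInner_le hd hr]

theorem isAdmissible_greenOp (hd : 4 ≤ d) (hB0 : 0 ≤ B) (hB1 : B ≤ 1) (hu : IsAdmissible d u) :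
    IsAdmissible d (greenOp d B u) := by
  have hintegral : ∀ a b : ℝ, 1 ≤ a → a ≤ b →
      0 ≤ ∫ s in a..b, s ^ (d + 1) * greenInner d u s := fun a b ha hab =>
    intervalIntegral.integral_nonneg hab fun s hs =>
      have hs1 : 1 ≤ s := ha.trans hs.1
      mul_nonneg (pow_nonneg (zero_le_one.trans hs1) _) (hu.greenInner_nonneg hd hs1)
  refine ⟨fun r hr s hs hrs => ?_, fun r hr => ?_, fun r hr => hu.greenOp_le hd hB1 hr⟩
  · have hr1 : 1 ≤ r := hr
    have hs1 : 1 ≤ s := hs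
    have hadd := intervalIntegral.integral_add_adjacent_intervals
      (hu.intervalIntegrable_pow_mul_greenInner hd le_rfl hr1)
      (hu.intervalIntegrable_pow_mul_greenInner hd hr1 hrs)
    simp only [pow_mul_greenOp d B u (zero_lt_one.trans_le hr1).ne',
      pow_mul_greenOp d B u (zero_lt_one.trans_le hs1).ne']
    linarith [hintegral r s hr1 hrs]
  · exact div_nonneg (add_nonneg hB0 (hintegral 1 r le_rfl hr))
      (pow_nonneg (zero_le_one.trans hr) d)

theorem iSup {ι : Type*} [Nonempty ι] {f : ι → ℝ → ℝ} (hf : ∀ i, IsAdmissible d (f i)) :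
    IsAdmissible d fun r => ⨆ i, f i r := by
  have hle : ∀ i r, 1 ≤ r → f i r ≤ ⨆ i, f i r := fun i r hr =>
    le_ciSup (f := fun i => f i r) ⟨_, forall_mem_range.2 fun i => (hf i).le r hr⟩ i
  refine ⟨fun r hr s hs hrs => ?_, fun r hr => ?_, fun r hr => ciSup_le fun i => (hf i).le r hr⟩
  · have hr0 : 0 < r := zero_lt_one.trans_le hr
    have hs0 : 0 < s := zero_lt_one.trans_le hs
    simp only
    rw [Real.mul_iSup_of_nonneg (by positivity)]
    refine ciSup_le fun i => ((hf i).monotoneOn hr hs hrs).trans ?_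
    exact mul_le_mul_of_nonneg_left (hle i s hs) (by positivity)
  · exact ((hf (Classical.arbitrary ι)).nonneg r hr).trans (hle _ r hr)

/-- The supremum of all admissible functions lying below their image is a fixed point, as in the
Knaster–Tarski theorem. -/
theorem exists_greenOp_eq (hd : 4 ≤ d) (hB0 : 0 ≤ B) (hB1 : B ≤ 1) (hu : IsAdmissible d u)
    (hle : ∀ r, 1 ≤ r → u r ≤ greenOp d B u r) :
    ∃ w, IsAdmissible d w ∧ (∀ r, 1 ≤ r → u r ≤ w r) ∧ ∀ r, 1 ≤ r → w r = greenOp d B w r := by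
  let P := {v : ℝ → ℝ // IsAdmissible d v ∧ ∀ r, 1 ≤ r → v r ≤ greenOp d B v r}
  have : Nonempty P := ⟨⟨u, hu, hle⟩⟩
  let U : ℝ → ℝ := fun r => ⨆ v : P, v.1 r
  have hU : IsAdmissible d U := .iSup fun v : P => v.2.1
  have hle_U : ∀ (v : P) r, 1 ≤ r → v.1 r ≤ U r := fun v r hr =>
    le_ciSup (f := fun v : P => v.1 r) ⟨_, forall_mem_range.2 fun v => v.2.1.le r hr⟩ v
  have hU_le : ∀ r, 1 ≤ r → U r ≤ greenOp d B U r := fun r hr =>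
    ciSup_le fun v => (v.2.2 r hr).trans (v.2.1.greenOp_mono hd B hU (hle_U v) hr)
  have hgreen := hU.isAdmissible_greenOp hd hB0 hB1
  have hgreen_le : ∀ r, 1 ≤ r → greenOp d B U r ≤ U r :=
    hle_U ⟨_, hgreen, fun r hr => hU.greenOp_mono hd B hgreen hU_le hr⟩
  exact ⟨U, hU, hle_U ⟨u, hu, hle⟩, fun r hr => le_antisymm (hU_le r hr) (hgreen_le r hr)⟩

theorem hasDerivAt_of_greenOp_eq (hd : 4 ≤ d) (hu : IsAdmissible d u)
    (hfix : ∀ r, 1 ≤ r → u r = greenOp d B u r) (hr : 1 < r) :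
    HasDerivAt u (r * greenInner d u r - d * u r / r) r := by
  have hr0 : r ≠ 0 := (zero_lt_one.trans hr).ne'
  have hgreen := ((hu.hasDerivAt_integral_pow_mul_greenInner hd hr).const_add B).div
    (hasDerivAt_pow d r) (pow_ne_zero d hr0)
  have hfix_nhds : u =ᶠ[𝓝 r] greenOp d B u := by
    filter_upwards [Ioi_mem_nhds hr] with s hs using hfix s (mem_Ioi.1 hs).le
  refine (hgreen.congr_of_eventuallyEq hfix_nhds).congr_deriv ?_
  rw [← pow_mul_greenOp d B u hr0, ← hfix r hr.le]
  obtain ⟨k, rfl⟩ : ∃ k, d = k + 1 := ⟨d - 1, by omega⟩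
  rw [add_tsub_cancel_right]
  field_simp
  ring

theorem isNonnegSolution_of_greenOp_eq (hd : 4 ≤ d) (hu : IsAdmissible d u)
    (hfix : ∀ r, 1 ≤ r → u r = greenOp d B u r) : IsNonnegSolution d u := by
  have hderiv : ∀ r, 1 < r → HasDerivAt u (r * greenInner d u r - d * u r / r) r := fun r hr =>
    hu.hasDerivAt_of_greenOp_eq hd hfix hr
  have hcont : ContinuousOn u (Ioi 1) := fun r hr => (hderiv r hr).continuousAt.continuousWithinAt
  refine .of_hasDerivAt (h := fun r => r ^ 2 * greenInner d u r - 2 * u r)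
    (fun r hr => hu.nonneg r hr.le) (fun r hr => ?_) (fun r hr => ?_) <;>
  have hr0 : r ≠ 0 := (zero_lt_one.trans hr).ne'
  · refine (hderiv r hr).congr_deriv ?_
    field_simp
    ring
  · refine (((hasDerivAt_pow 2 r).mul (hu.hasDerivAt_greenInner hd hcont hr)).sub
      ((hderiv r hr).const_mul 2)).congr_deriv ?_
    rw [greenSource]
    field_simp
    ring

end IsAdmissible

end Green

section Subsolution

variable {d : ℕ} {φ : ℝ → ℝ} {r : ℝ}

/-- A subsolution on `(1, ∞)` to which the Green operator can be applied: it is bounded by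
`1 / r ^ 2`, and `r ^ d φ` is nondecreasing, which in terms of the flux is the condition
`0 ≤ flux + 2 φ`. -/
structure IsGreenSubsolution (d : ℕ) (φ : ℝ → ℝ) : Prop where
  continuousOn : ContinuousOn φ (Ici 1)
  nonneg : ∀ r : ℝ, 1 ≤ r → 0 ≤ φ r
  le : ∀ r : ℝ, 1 ≤ r → φ r ≤ 1 / r ^ 2
  differentiableAt : ∀ r : ℝ, 1 < r → DifferentiableAt ℝ φ r
  flux_add_nonneg : ∀ r : ℝ, 1 < r → 0 ≤ flux d φ r + 2 * φ r
  differentiableAt_flux : ∀ r : ℝ, 1 < r → DifferentiableAt ℝ (flux d φ) r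
  le_deriv_flux : ∀ r : ℝ, 1 < r → 4 * r * φ r ^ 2 ≤ deriv (flux d φ) r

theorem hasDerivAt_pow_mul_of_flux (hφ : DifferentiableAt ℝ φ r) (hr : r ≠ 0) :
    HasDerivAt (fun r => r ^ d * φ r) (r ^ (d + 1) * ((flux d φ r + 2 * φ r) / r ^ 2)) r := by
  refine ((hasDerivAt_pow d r).mul (hasDerivAt_of_flux (d := d) hφ hr)).congr_deriv ?_
  rcases d with _ | d
  · field_simp
    ring
  · rw [add_tsub_cancel_right]
    field_simp
    ring

namespace IsGreenSubsolution

theorem isDecayingSubharmonic (hφ : IsGreenSubsolution d φ) : IsDecayingSubharmonic d φ where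
  nonneg r hr := hφ.nonneg r hr.le
  differentiableAt := hφ.differentiableAt
  monotoneOn_flux := monotoneOn_Ioi_of_hasDerivAt_nonneg
    (fun x hx => (hφ.differentiableAt_flux x hx).hasDerivAt) fun x hx =>
    le_trans (by positivity) (hφ.le_deriv_flux x hx)
  tendsto_zero := by
    refine tendsto_of_tendsto_of_tendsto_of_le_of_le' tendsto_const_nhds
      (tendsto_const_nhds.div_atTop (tendsto_pow_atTop two_ne_zero) :
        Tendsto (fun r : ℝ => 1 / r ^ 2) atTop (𝓝 0)) ?_ ?_
    · filter_upwards [eventually_ge_atTop 1] with r hr using hφ.nonneg r hr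
    · filter_upwards [eventually_ge_atTop 1] with r hr using hφ.le r hr

theorem isAdmissible (hφ : IsGreenSubsolution d φ) : IsAdmissible d φ where
  monotoneOn := by
    refine monotoneOn_of_hasDerivWithinAt_nonneg (convex_Ici 1)
      ((continuousOn_pow d).mul hφ.continuousOn) (f' := fun r =>
        r ^ (d + 1) * ((flux d φ r + 2 * φ r) / r ^ 2)) ?_ ?_ <;>
    · rw [interior_Ici]
      intro r hr
      have hr0 : 0 < r := zero_lt_one.trans hr
      have := hφ.flux_add_nonneg r hr
      first
        | positivity
        | exact (hasDerivAt_pow_mul_of_flux (hφ.differentiableAt r hr) hr0.ne').hasDerivWithinAt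
  nonneg := hφ.nonneg
  le := hφ.le

theorem flux_add_div_sq_le_greenInner (hd : 4 ≤ d) (hφ : IsGreenSubsolution d φ) (hr : 1 < r) :
    (flux d φ r + 2 * φ r) / r ^ 2 ≤ greenInner d φ r := by
  have hsub := hφ.isDecayingSubharmonic
  have hlim : Tendsto (fun x => (flux d φ x + 2 * φ x) / x ^ 2) atTop (𝓝 0) :=
    ((hsub.tendsto_flux (by omega)).add (hsub.tendsto_zero.const_mul 2)).div_atTop
      (tendsto_pow_atTop two_ne_zero)
  refine le_of_hasDerivAt_le_of_tendsto_sub (f' := fun x => -greenSource d φ x)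
    (g' := fun x => deriv (flux d φ) x / x ^ 2 - 2 * d * φ x / x ^ 3)
    (fun x hx => hφ.isAdmissible.hasDerivAt_greenInner hd
      (hφ.continuousOn.mono Ioi_subset_Ici_self) hx) (fun x hx => ?_) (fun x hx => ?_)
    (by simpa using (hφ.isAdmissible.tendsto_greenInner hd).sub hlim) hr <;>
  have hx0 : 0 < x := zero_lt_one.trans hx
  · refine (((hφ.differentiableAt_flux x hx).hasDerivAt.add
      ((hsub.hasDerivAt hx).const_mul 2)).div (hasDerivAt_pow 2 x)
      (pow_ne_zero 2 hx0.ne')).congr_deriv ?_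
    simp only [Pi.add_apply]
    field_simp
    ring
  · have hsource : 4 * φ x ^ 2 / x = 4 * x * φ x ^ 2 / x ^ 2 := by field_simp
    rw [greenSource, neg_sub, hsource]
    gcongr
    exact hφ.le_deriv_flux x hx

theorem le_greenOp (hd : 4 ≤ d) (hφ : IsGreenSubsolution d φ) (hr : 1 ≤ r) :
    φ r ≤ greenOp d (φ 1) φ r := by
  have hadm := hφ.isAdmissible
  have hprim := intervalIntegral.continuousOn_primitive_interval'
    (hadm.intervalIntegrable_pow_mul_greenInner hd le_rfl hr) (a := 1) (by simp)
  rw [uIcc_of_le hr] at hprim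
  have hmono : MonotoneOn
      (fun r => (∫ s in (1 : ℝ)..r, s ^ (d + 1) * greenInner d φ s) - r ^ d * φ r) (Icc 1 r) := by
    refine monotoneOn_of_hasDerivWithinAt_nonneg (convex_Icc 1 r)
      (hprim.sub ((continuousOn_pow d).mul (hφ.continuousOn.mono Icc_subset_Ici_self)))
      (fun x hx => ?_) (f' := fun x => x ^ (d + 1) * greenInner d φ x -
        x ^ (d + 1) * ((flux d φ x + 2 * φ x) / x ^ 2)) fun x hx => ?_ <;>
    rw [interior_Icc] at hx <;>
    have hx0 : 0 < x := zero_lt_one.trans hx.1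
    · exact ((hadm.hasDerivAt_integral_pow_mul_greenInner hd hx.1).sub
        (hasDerivAt_pow_mul_of_flux (hφ.differentiableAt x hx.1) hx0.ne')).hasDerivWithinAt
    · have := hφ.flux_add_div_sq_le_greenInner hd hx.1
      rw [sub_nonneg]
      gcongr
  have hle := hmono ⟨le_rfl, hr⟩ ⟨hr, le_rfl⟩ hr
  simp only [intervalIntegral.integral_same, one_pow, one_mul] at hle
  rw [greenOp, le_div_iff₀ (pow_pos (zero_lt_one.trans_le hr) d)]
  linarith

theorem exists_isNonnegSolution_ge (hd : 4 ≤ d) (hφ : IsGreenSubsolution d φ) :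
    ∃ u, IsNonnegSolution d u ∧ ∀ r, 1 < r → φ r ≤ u r := by
  obtain ⟨u, hu, hle, hfix⟩ := hφ.isAdmissible.exists_greenOp_eq hd (hφ.nonneg 1 le_rfl)
    (by simpa using hφ.le 1 le_rfl) fun r hr => hφ.le_greenOp hd hr
  exact ⟨u, hu.isNonnegSolution_of_greenOp_eq hd hfix, fun r hr => hle r hr.le⟩

theorem of_hasDerivAt {h h' : ℝ → ℝ} (hcont : ContinuousOn φ (Ici 1))
    (h0 : ∀ r, 1 ≤ r → 0 ≤ φ r) (hle : ∀ r, 1 ≤ r → φ r ≤ 1 / r ^ 2)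
    (hφ : ∀ r, 1 < r → HasDerivAt φ ((h r - ((d : ℝ) - 2) * φ r) / r) r)
    (hadd : ∀ r, 1 < r → 0 ≤ h r + 2 * φ r) (hh : ∀ r, 1 < r → HasDerivAt h (h' r) r)
    (hsub : ∀ r, 1 < r → 4 * r * φ r ^ 2 ≤ h' r) : IsGreenSubsolution d φ := by
  have hflux : EqOn (flux d φ) h (Ioi 1) := fun r hr => by
    rw [flux, (hφ r hr).deriv, mul_div_cancel₀ _ (zero_lt_one.trans hr).ne', add_sub_cancel]
  have hderiv : ∀ r, 1 < r → HasDerivAt (flux d φ) (h' r) r := fun r hr =>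
    (hh r hr).congr_of_eventuallyEq (eventuallyEq_of_mem (Ioi_mem_nhds hr) hflux)
  exact ⟨hcont, h0, hle, fun r hr => (hφ r hr).differentiableAt,
    fun r hr => (hflux hr).symm ▸ hadd r hr, fun r hr => (hderiv r hr).differentiableAt,
    fun r hr => (hderiv r hr).deriv.symm ▸ hsub r hr⟩

end IsGreenSubsolution

theorem isGreenSubsolution_div_pow (k : ℕ) :
    IsGreenSubsolution (k + 4) fun r => 1 / 2 / r ^ (k + 3) := by
  have hφ : ∀ r : ℝ, r ≠ 0 → HasDerivAt (fun r : ℝ => 1 / 2 / r ^ (k + 3))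
      (-((k + 3) / 2 / r ^ (k + 4))) r := fun r hr => by
    refine ((hasDerivAt_const r (1 / 2 : ℝ)).div (hasDerivAt_pow (k + 3) r)
      (pow_ne_zero _ hr)).congr_deriv ?_
    rw [show k + 3 - 1 = k + 2 by omega]
    push_cast
    field_simp
    ring
  refine .of_hasDerivAt (h := fun r => -(1 / 2 / r ^ (k + 3)))
    (fun r hr => (hφ r (zero_lt_one.trans_le hr).ne').continuousAt.continuousWithinAt)
    (fun r hr => by positivity) (fun r hr => ?_) (fun r hr => ?_)
    (fun r hr => ?_) (fun r hr => (hφ r (zero_lt_one.trans hr).ne').neg) (fun r hr => ?_)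
  · gcongr
    · norm_num
    · omega
  · refine (hφ r (zero_lt_one.trans hr).ne').congr_deriv ?_
    push_cast
    field_simp
    ring
  · have : 0 ≤ 1 / 2 / r ^ (k + 3) := by positivity
    linarith
  · have : (0 : ℝ) ≤ k := k.cast_nonneg
    calc 4 * r * (1 / 2 / r ^ (k + 3)) ^ 2 = 1 / r ^ (k + 4) * (1 / r ^ (k + 1)) := by
          field_simp
          ring
      _ ≤ 1 / r ^ (k + 4) * ((k + 3) / 2) := by
          have : 1 / r ^ (k + 1) ≤ 1 :=
            div_le_one_of_le₀ (one_le_pow₀ hr.le) (by positivity)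
          exact mul_le_mul_of_nonneg_left (by linarith) (by positivity)
      _ = - -((k + 3) / 2 / r ^ (k + 4)) := by ring

theorem IsMaximalNonnegSolution.pos (hd : 4 ≤ d) {u : ℝ → ℝ} (hu : IsMaximalNonnegSolution d u)
    (hr : 1 < r) : 0 < u r := by
  obtain ⟨k, rfl⟩ : ∃ k, d = k + 4 := ⟨d - 4, by omega⟩
  obtain ⟨v, hv, hle⟩ := (isGreenSubsolution_div_pow k).exists_isNonnegSolution_ge hd
  exact (by positivity : 0 < 1 / 2 / r ^ (k + 3)).trans_le
    ((hle r hr).trans (hu.le_of_isNonnegSolution v hv r hr))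

end Subsolution

section Asymptotics

variable {d k : ℕ} {u : ℝ → ℝ} {a r : ℝ}

namespace IsNonnegSolution

theorem neg_flux_le_sq (hd : 4 ≤ d) (hu : IsNonnegSolution d u) (hr : 1 < r) :
    ((d : ℝ) - 3) * -flux d u r ≤ 2 * (r * u r) ^ 2 := by
  have hsub := hu.isDecayingSubharmonic (by omega)
  have hlim : Tendsto (fun x => 2 * (x * u x) ^ 2 - ((d : ℝ) - 3) * -flux d u x) atTop (𝓝 0) := by
    simpa using (((hu.tendsto_mul_zero (by omega)).pow 2).const_mul 2).sub
      ((hsub.tendsto_flux (by omega)).neg.const_mul ((d : ℝ) - 3))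
  refine le_of_hasDerivAt_le_of_tendsto_sub
    (f' := fun x => ((d : ℝ) - 3) * -(4 * x * u x ^ 2) + 4 * x * u x * flux d u x)
    (fun x hx => ?_) (fun x hx => (hu.hasDerivAt_flux hx).neg.const_mul ((d : ℝ) - 3))
    (fun x hx => ?_) hlim hr
  · have hx0 : x ≠ 0 := (zero_lt_one.trans hx).ne'
    refine ((((hasDerivAt_id x).mul (hsub.hasDerivAt hx)).pow 2).const_mul 2).congr_deriv ?_
    simp only [id, Pi.mul_apply]
    field_simp
    ring
  · have hxu : 0 ≤ 4 * x * u x := mul_nonneg (by linarith) (hu.nonneg x hx)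
    linarith [mul_nonpos_of_nonneg_of_nonpos hxu (hsub.flux_nonpos hx)]

theorem pow_mul_le_add (hu : IsNonnegSolution (k + 5) u)
    (ha : Tendsto (fun r => r ^ (k + 3) * u r) atTop (𝓝 a)) (hr : 1 < r) :
    r ^ (k + 3) * u r ≤ a + (r ^ (k + 3) * u r) ^ 2 / r ^ (k + 1) := by
  have hsub : IsDecayingSubharmonic (k + 3 + 2) u := hu.isDecayingSubharmonic (by omega)
  have hlim : Tendsto (fun x => a + (x ^ (k + 3) * u x) ^ 2 / x ^ (k + 1) - x ^ (k + 3) * u x)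
      atTop (𝓝 0) := by
    simpa using (((ha.pow 2).div_atTop (tendsto_pow_atTop k.succ_ne_zero)).const_add a).sub ha
  refine le_of_hasDerivAt_le_of_tendsto_sub
    (f := fun x => a + (x ^ (k + 3) * u x) ^ 2 / x ^ (k + 1)) (f' := fun x =>
      2 * x ^ (k + 4) * u x * flux (k + 5) u x - (k + 1) * x ^ (k + 4) * u x ^ 2)
    (g' := fun x => x ^ (k + 3) * flux (k + 5) u x / x)
    (fun x hx => ?_) (fun x hx => hsub.hasDerivAt_pow_mul hx) (fun x hx => ?_) hlim hr <;>
  have hx0 : 0 < x := zero_lt_one.trans hx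
  · refine ((((hsub.hasDerivAt_pow_mul hx).pow 2).div (hasDerivAt_pow (k + 1) x)
      (pow_ne_zero _ hx0.ne')).const_add a).congr_deriv ?_
    simp only [Pi.pow_apply, Nat.add_sub_cancel]
    push_cast
    field_simp
    ring
  · have hflux := hu.neg_flux_le_sq (by omega) hx
    have hflux0 := hsub.flux_nonpos hx
    have hk : (0 : ℝ) ≤ k := k.cast_nonneg
    have hu0 := hu.nonneg x hx
    push_cast at hflux
    have hxu : -flux (k + 5) u x ≤ (k + 1) * (x * u x) ^ 2 := by
      nlinarith [mul_nonneg hk (sq_nonneg (x * u x)),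
        mul_nonneg hk (mul_nonneg hk (sq_nonneg (x * u x)))]
    have hprod : 2 * x ^ (k + 4) * u x * flux (k + 5) u x ≤ 0 :=
      mul_nonpos_of_nonneg_of_nonpos (by positivity) hflux0
    have := mul_le_mul_of_nonneg_left hxu (pow_nonneg hx0.le (k + 2))
    calc _ ≤ -(x ^ (k + 2) * ((k + 1) * (x * u x) ^ 2)) := by linear_combination hprod
      _ ≤ x ^ (k + 2) * flux (k + 5) u x := by linarith
      _ = _ := by field_simp; ring

theorem exists_tendsto_pow_mul (hu : IsNonnegSolution (k + 5) u) (hpos : ∀ r, 1 < r → 0 < u r) :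
    ∃ a, 0 < a ∧ Tendsto (fun r => r ^ (k + 3) * u r) atTop (𝓝 a) ∧
      ∀ r, 1 < r → a ≤ r ^ (k + 3) * u r := by
  have hsub : IsDecayingSubharmonic (k + 3 + 2) u := hu.isDecayingSubharmonic (by omega)
  obtain ⟨a, ha0, ha, hle⟩ := exists_tendsto_of_antitoneOn hsub.antitoneOn_pow_mul
    fun r hr => mul_nonneg (pow_nonneg (by linarith) _) (hu.nonneg r hr)
  refine ⟨a, ha0.lt_of_ne ?_, ha, hle⟩
  rintro rfl
  obtain ⟨r, hsmall, hr⟩ := ((ha.eventually_lt_const one_pos).and (eventually_gt_atTop 1)).exists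
  have hm : 0 < r ^ (k + 3) * u r := mul_pos (by positivity) (hpos r hr)
  have hself := hu.pow_mul_le_add ha hr
  rw [zero_add, le_div_iff₀ (by positivity), sq] at hself
  linarith [le_of_mul_le_mul_left hself hm, one_le_pow₀ (n := k + 1) hr.le]

end IsNonnegSolution

theorem IsMaximalNonnegSolution.exists_asymptotics {r₀ : ℝ} (hr₀ : 1 < r₀) :
    ∃ a₀ b₀ b₁ : ℝ, 0 < a₀ ∧ 0 < b₀ ∧ 0 < b₁ ∧
      ∀ u : ℝ → ℝ, IsMaximalNonnegSolution (k + 5) u →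
        Tendsto (fun r => r ^ (k + 3) * u r) atTop (𝓝 a₀) ∧
        (∀ r, 1 < r → a₀ ≤ r ^ (k + 3) * u r) ∧
        (∀ r, r₀ ≤ r → r ^ (k + 3) * u r ≤ b₀) ∧
        (∀ r, r₀ ≤ r → r ^ (k + 3) * u r ≤ a₀ + b₁ / r ^ (k + 1)) := by
  obtain ⟨w, hw⟩ := exists_isMaximalNonnegSolution (d := k + 5) (by omega)
  have hsub : IsDecayingSubharmonic (k + 3 + 2) w :=
    hw.isNonnegSolution.isDecayingSubharmonic (by omega)
  have hpos : ∀ r, 1 < r → 0 < w r := fun r hr => hw.pos (by omega) hr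
  obtain ⟨a, ha0, ha, hle⟩ := hw.isNonnegSolution.exists_tendsto_pow_mul hpos
  have hb₀ : 0 < r₀ ^ (k + 3) * w r₀ := mul_pos (by positivity) (hpos r₀ hr₀)
  have hmono : ∀ r, r₀ ≤ r → r ^ (k + 3) * w r ≤ r₀ ^ (k + 3) * w r₀ := fun r hr =>
    hsub.antitoneOn_pow_mul hr₀ (hr₀.trans_le hr) hr
  refine ⟨a, r₀ ^ (k + 3) * w r₀, (r₀ ^ (k + 3) * w r₀) ^ 2, ha0, hb₀, pow_pos hb₀ 2,
    fun u hu => ⟨ha.congr' ?_, fun r hr => ?_, fun r hr => ?_, fun r hr => ?_⟩⟩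
  · filter_upwards [eventually_gt_atTop 1] with r hr
    rw [hu.eq hw hr]
  · rw [hu.eq hw hr]
    exact hle r hr
  · rw [hu.eq hw (hr₀.trans_le hr)]
    exact hmono r hr
  · have hr1 := hr₀.trans_le hr
    have hm : 0 ≤ r ^ (k + 3) * w r := mul_nonneg (by positivity) (hpos r hr1).le
    have hmle := hmono r hr
    rw [hu.eq hw hr1]
    refine (hw.isNonnegSolution.pow_mul_le_add ha hr1).trans ?_
    gcongr

theorem IsMaximalNonnegSolution.asymptotics_of_five_le (hd : 5 ≤ d) {r₀ : ℝ} (hr₀ : 1 < r₀) :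
    ∃ a₀ b₀ b₁ : ℝ, 0 < a₀ ∧ 0 < b₀ ∧ 0 < b₁ ∧
      ∀ u : ℝ → ℝ, IsMaximalNonnegSolution d u →
        Tendsto (fun r : ℝ => r ^ ((d : ℤ) - 2) * u r) atTop (𝓝 a₀) ∧
        (∀ r : ℝ, 1 < r → a₀ * r ^ (2 - (d : ℤ)) ≤ u r) ∧
        (∀ r : ℝ, r₀ ≤ r → u r ≤ b₀ * r ^ (2 - (d : ℤ))) ∧
        (∀ r : ℝ, r₀ ≤ r →
          u r ≤ a₀ * r ^ (2 - (d : ℤ)) + b₁ * r ^ (6 - 2 * (d : ℤ))) := by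
  obtain ⟨k, rfl⟩ : ∃ k, d = k + 5 := ⟨d - 5, by omega⟩
  obtain ⟨a, b₀, b₁, ha0, hb₀, hb₁, hasymp⟩ :=
    IsMaximalNonnegSolution.exists_asymptotics (k := k) hr₀
  refine ⟨a, b₀, b₁, ha0, hb₀, hb₁, fun u hu => ?_⟩
  have hexp₁ : ((k + 5 : ℕ) : ℤ) - 2 = (k + 3 : ℕ) := by push_cast; ring
  have hexp₂ : 2 - ((k + 5 : ℕ) : ℤ) = -(k + 3 : ℕ) := by push_cast; ring
  have hexp₃ : 6 - 2 * ((k + 5 : ℕ) : ℤ) = -(2 * k + 4 : ℕ) := by push_cast; ring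
  simp only [hexp₁, hexp₂, hexp₃, zpow_neg, zpow_natCast, ← div_eq_mul_inv]
  obtain ⟨hlim, hlower, hupper, hrefined⟩ := hasymp u hu
  refine ⟨hlim, fun r hr => ?_, fun r hr => ?_, fun r hr => ?_⟩
  · rw [div_le_iff₀' (by positivity)]
    exact hlower r hr
  · have hr0 : 0 < r := by linarith
    rw [le_div_iff₀' (by positivity)]
    exact hupper r hr
  · have hr0 : 0 < r := by linarith
    calc u r ≤ (a + b₁ / r ^ (k + 1)) / r ^ (k + 3) := by
          rw [le_div_iff₀' (by positivity)]
          exact hrefined r hr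
      _ = a / r ^ (k + 3) + b₁ / r ^ (2 * k + 4) := by
          field_simp
          ring

end Asymptotics

section DimensionFour

variable {u : ℝ → ℝ} {r : ℝ}

theorem one_half_lt_log_two_mul (hr : 1 ≤ r) : 1 / 2 < Real.log (2 * r) := by
  have hmono : Real.log 2 ≤ Real.log (2 * r) := Real.log_le_log two_pos (by linarith)
  linarith [Real.log_two_gt_d9]

theorem log_two_mul_pos (hr : 1 ≤ r) : 0 < Real.log (2 * r) :=
  one_half_pos.trans (one_half_lt_log_two_mul hr)

theorem hasDerivAt_log_two_mul (hr : r ≠ 0) :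
    HasDerivAt (fun r => Real.log (2 * r)) (1 / r) r := by
  refine (((hasDerivAt_id r).const_mul 2).log (by simpa)).congr_deriv ?_
  simp only [id]
  field_simp

theorem hasDerivAt_inv_sq_mul_inv_log_two_mul_pow (n : ℕ) (hr : 1 ≤ r) :
    HasDerivAt (fun r => 1 / 2 * (r ^ 2)⁻¹ * (Real.log (2 * r) ^ n)⁻¹)
      (-(r ^ 3)⁻¹ * ((Real.log (2 * r) ^ n)⁻¹ + n / 2 * (Real.log (2 * r) ^ (n + 1))⁻¹)) r := by
  have hr0 : 0 < r := zero_lt_one.trans_le hr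
  have hl := log_two_mul_pos hr
  refine ((((hasDerivAt_pow 2 r).inv (by positivity)).const_mul (1 / 2)).mul
    (((hasDerivAt_log_two_mul hr0.ne').pow n).inv (by
      simp only [Pi.pow_apply]; positivity))).congr_deriv ?_
  simp only [Pi.inv_apply, Pi.pow_apply]
  generalize Real.log (2 * r) = l at hl ⊢
  rcases n with _ | n
  · field_simp
    ring
  · rw [add_tsub_cancel_right]
    push_cast
    field_simp
    ring

theorem isGreenSubsolution_log :
    IsGreenSubsolution 4 fun r => 1 / 2 * (r ^ 2)⁻¹ * (Real.log (2 * r))⁻¹ := by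
  have hφ : ∀ r : ℝ, 1 ≤ r → HasDerivAt (fun r => 1 / 2 * (r ^ 2)⁻¹ * (Real.log (2 * r))⁻¹)
      ((-(1 / 2 * (r ^ 2)⁻¹ * ((Real.log (2 * r)) ^ 2)⁻¹) -
        (((4 : ℕ) : ℝ) - 2) * (1 / 2 * (r ^ 2)⁻¹ * (Real.log (2 * r))⁻¹)) / r) r := fun r hr => by
    refine (by simpa only [pow_one] using
      hasDerivAt_inv_sq_mul_inv_log_two_mul_pow 1 hr : HasDerivAt _ _ r).congr_deriv ?_
    push_cast
    field_simp
    ring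
  refine .of_hasDerivAt (fun r hr => (hφ r hr).continuousAt.continuousWithinAt)
    (fun r hr => ?_) (fun r hr => ?_) (fun r hr => hφ r hr.le) (fun r hr => ?_)
    (fun r hr => (hasDerivAt_inv_sq_mul_inv_log_two_mul_pow 2 hr.le).neg) (fun r hr => ?_)
  · have := log_two_mul_pos hr
    positivity
  · have hl := one_half_lt_log_two_mul hr
    rw [one_div (r ^ 2), mul_right_comm]
    refine mul_le_of_le_one_left (by positivity) ?_
    rw [← div_eq_mul_inv, div_le_one (log_two_mul_pos hr)]
    exact hl.le
  · have hl := one_half_lt_log_two_mul hr.le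
    calc (0 : ℝ) ≤ (r ^ 2)⁻¹ * (Real.log (2 * r) ^ 2)⁻¹ * (Real.log (2 * r) - 1 / 2) :=
          mul_nonneg (by positivity) (by linarith)
      _ = _ := by
          field_simp
          ring
  · have hl := log_two_mul_pos hr.le
    calc 4 * r * (1 / 2 * (r ^ 2)⁻¹ * (Real.log (2 * r))⁻¹) ^ 2
        = (r ^ 3)⁻¹ * (Real.log (2 * r) ^ 2)⁻¹ := by
          field_simp
          ring
      _ ≤ (r ^ 3)⁻¹ * ((Real.log (2 * r) ^ 2)⁻¹ + (Real.log (2 * r) ^ 3)⁻¹) := by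
          gcongr
          exact le_add_of_nonneg_right (by positivity)
      _ = _ := by
          push_cast
          ring

theorem inv_two_mul_sub_sub_le {s t : ℝ} (ht : 0 < t) (hs : 0 ≤ s) (hst : s ≤ t) :
    (2 * t - s)⁻¹ - 1 / (2 * t) ≤ s / (2 * t ^ 2) := by
  have h2ts : t ≤ 2 * t - s := by linarith
  have h2ts0 : 0 < 2 * t - s := ht.trans_le h2ts
  calc (2 * t - s)⁻¹ - 1 / (2 * t) = s / (2 * t * (2 * t - s)) := by
        field_simp
        ring
    _ ≤ s / (2 * t * t) := by gcongr
    _ = s / (2 * t ^ 2) := by ring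

namespace IsNonnegSolution

theorem hasDerivAt_sq_mul (hu : IsNonnegSolution 4 u) (hr : 1 < r) :
    HasDerivAt (fun r => r ^ 2 * u r) (r * flux 4 u r) r := by
  have hsub : IsDecayingSubharmonic (2 + 2) u := hu.isDecayingSubharmonic (by norm_num)
  have hr0 : r ≠ 0 := by positivity
  refine (hsub.hasDerivAt_pow_mul hr).congr_deriv ?_
  field_simp

theorem tendsto_sq_mul (hu : IsNonnegSolution 4 u) :
    Tendsto (fun r => r ^ 2 * u r) atTop (𝓝 0) := by
  have hsub : IsDecayingSubharmonic (2 + 2) u := hu.isDecayingSubharmonic (by norm_num)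
  obtain ⟨a, ha0, ha, hle⟩ := exists_tendsto_of_antitoneOn hsub.antitoneOn_pow_mul
    fun r hr => mul_nonneg (sq_nonneg r) (hu.nonneg r hr)
  rcases ha0.eq_or_lt with rfl | hpos
  · exact ha
  have hflux : ∀ r, 1 < r → 2 * a ^ 2 / r ^ 2 ≤ -flux 4 u r := fun r hr => by
    refine le_of_hasDerivAt_le_of_tendsto_sub (f := fun x => -flux 4 u x)
      (g := fun x => 2 * a ^ 2 / x ^ 2) (g' := fun x => -(4 * a ^ 2 / x ^ 3))
      (fun x hx => (hu.hasDerivAt_flux hx).neg) (fun x hx => ?_) (fun x hx => ?_) ?_ hr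
    · have hx0 : x ≠ 0 := by positivity
      refine ((hasDerivAt_const x (2 * a ^ 2)).div (hasDerivAt_pow 2 x)
        (pow_ne_zero 2 hx0)).congr_deriv ?_
      push_cast
      field_simp
      ring
    · have := hle x hx
      calc -(4 * x * u x ^ 2) = -(4 * (x ^ 2 * u x) ^ 2 / x ^ 3) := by field_simp
        _ ≤ -(4 * a ^ 2 / x ^ 3) := by gcongr
    · simpa using (hsub.tendsto_flux (by norm_num)).neg.sub
        ((tendsto_const_nhds (x := 2 * a ^ 2)).div_atTop (tendsto_pow_atTop two_ne_zero))
  refine absurd ha.neg (not_tendsto_nhds_of_tendsto_atTop (tendsto_atTop_of_div_le_hasDerivAt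
    (c := 2 * a ^ 2) (by positivity) (f' := fun r => -(r * flux 4 u r)) ?_ ?_) _)
  · filter_upwards [eventually_gt_atTop 1] with x hx using (hu.hasDerivAt_sq_mul hx).neg
  · filter_upwards [eventually_gt_atTop 1] with x hx
    have hx0 : 0 < x := zero_lt_one.trans hx
    calc 2 * a ^ 2 / x = x * (2 * a ^ 2 / x ^ 2) := by field_simp
      _ ≤ x * -flux 4 u x := mul_le_mul_of_nonneg_left (hflux x hx) hx0.le
      _ = -(x * flux 4 u x) := mul_neg _ _

theorem le_neg_flux (hu : IsNonnegSolution 4 u) (hr : 1 < r) :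
    2 * (r * u r) ^ 2 * (1 - 2 * (r ^ 2 * u r)) ≤ -flux 4 u r := by
  have hsub : IsDecayingSubharmonic 4 u := hu.isDecayingSubharmonic (by norm_num)
  refine le_of_hasDerivAt_le_of_tendsto_sub (f := fun x => -flux 4 u x)
    (g := fun x => 2 * (x * u x) ^ 2 * (1 - 2 * (x ^ 2 * u x)))
    (g' := fun x => 4 * x * u x * (flux 4 u x - u x) * (1 - 2 * (x ^ 2 * u x)) -
      4 * x ^ 3 * u x ^ 2 * flux 4 u x)
    (fun x hx => (hu.hasDerivAt_flux hx).neg) (fun x hx => ?_) (fun x hx => ?_) ?_ hr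
  · have hx0 : x ≠ 0 := by positivity
    refine (((((hasDerivAt_id x).mul (hsub.hasDerivAt hx)).pow 2).const_mul 2).mul
      (((hu.hasDerivAt_sq_mul hx).const_mul 2).const_sub 1)).congr_deriv ?_
    simp only [id, Pi.mul_apply, Pi.pow_apply]
    push_cast
    field_simp
    ring
  · have hux := hu.nonneg x hx
    have hupper := hu.neg_flux_le_sq le_rfl hx
    norm_num at hupper
    have hquad : 0 ≤ 4 * x * u x * (flux 4 u x + 2 * (x * u x) ^ 2) :=
      mul_nonneg (by positivity) (by linarith)
    have hcubic : 0 ≤ 12 * x ^ 3 * u x ^ 2 * -flux 4 u x :=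
      mul_nonneg (by positivity) (neg_nonneg.2 (hsub.flux_nonpos hx))
    linear_combination hquad + hcubic
  · simpa using (hsub.tendsto_flux (by norm_num)).neg.sub
      ((((hu.tendsto_mul_zero (by norm_num)).pow 2).const_mul 2).mul
        ((hu.tendsto_sq_mul.const_mul 2).const_sub 1))

theorem hasDerivAt_inv_sq_mul (hu : IsNonnegSolution 4 u) (hr : 1 < r) (hur : 0 < u r) :
    HasDerivAt (fun r => (r ^ 2 * u r)⁻¹) (-(r * flux 4 u r) / (r ^ 2 * u r) ^ 2) r :=
  (hu.hasDerivAt_sq_mul hr).inv (by positivity)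

theorem le_deriv_inv_sq_mul (hu : IsNonnegSolution 4 u) (hr : 1 < r) (hur : 0 < u r) :
    (2 - 4 * (r ^ 2 * u r)) / r ≤ -(r * flux 4 u r) / (r ^ 2 * u r) ^ 2 := by
  have hr0 : 0 < r := zero_lt_one.trans hr
  rw [le_div_iff₀ (by positivity)]
  calc (2 - 4 * (r ^ 2 * u r)) / r * (r ^ 2 * u r) ^ 2
      = r * (2 * (r * u r) ^ 2 * (1 - 2 * (r ^ 2 * u r))) := by
        field_simp
        ring
    _ ≤ r * -flux 4 u r := mul_le_mul_of_nonneg_left (hu.le_neg_flux hr) hr0.le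
    _ = -(r * flux 4 u r) := mul_neg _ _

theorem eventually_sq_mul_le_two_div_log (hu : IsNonnegSolution 4 u)
    (hpos : ∀ r, 1 < r → 0 < u r) : ∀ᶠ r in atTop, r ^ 2 * u r ≤ 2 / Real.log r := by
  obtain ⟨C, hC⟩ := exists_eventually_add_le_of_hasDerivAt_le
    (f := fun r => (r ^ 2 * u r)⁻¹) (g := Real.log) (g' := fun r => r⁻¹)
    (f' := fun r => -(r * flux 4 u r) / (r ^ 2 * u r) ^ 2)
    (by
      filter_upwards [eventually_gt_atTop 1] with r hr
      exact hu.hasDerivAt_inv_sq_mul hr (hpos r hr))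
    (by filter_upwards [eventually_gt_atTop 0] with r hr using Real.hasDerivAt_log hr.ne')
    (by
      filter_upwards [eventually_gt_atTop 1,
        hu.tendsto_sq_mul.eventually_le_const (by norm_num : (0 : ℝ) < 1 / 4)] with r hr hsmall
      refine le_trans ?_ (hu.le_deriv_inv_sq_mul hr (hpos r hr))
      rw [inv_eq_one_div]
      gcongr
      linarith)
  filter_upwards [hC, eventually_gt_atTop 1, Real.tendsto_log_atTop.eventually_ge_atTop (-2 * C)]
    with r hCr hr hlog
  have hlog0 : 0 < Real.log r := Real.log_pos hr
  have hm : 0 < r ^ 2 * u r := mul_pos (by positivity) (hpos r hr)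
  rw [← inv_div, le_inv_comm₀ hm (by positivity)]
  linarith

theorem exists_eventually_le_inv_sq_mul (hu : IsNonnegSolution 4 u)
    (hpos : ∀ r, 1 < r → 0 < u r) :
    ∃ C, ∀ᶠ r in atTop, 2 * Real.log r - 8 * Real.log (Real.log r) + C ≤ (r ^ 2 * u r)⁻¹ := by
  refine exists_eventually_add_le_of_hasDerivAt_le
    (g' := fun r => 2 * r⁻¹ - 8 * (r⁻¹ / Real.log r))
    (f' := fun r => -(r * flux 4 u r) / (r ^ 2 * u r) ^ 2) ?_ ?_ ?_
  · filter_upwards [eventually_gt_atTop 1] with r hr using hu.hasDerivAt_inv_sq_mul hr (hpos r hr)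
  · filter_upwards [eventually_gt_atTop 1] with r hr
    have hlog := Real.hasDerivAt_log (zero_lt_one.trans hr).ne'
    exact (hlog.const_mul 2).sub ((hlog.log (Real.log_pos hr).ne').const_mul 8)
  · filter_upwards [eventually_gt_atTop 1, hu.eventually_sq_mul_le_two_div_log hpos] with r hr hle
    have hlog0 := Real.log_pos hr
    calc 2 * r⁻¹ - 8 * (r⁻¹ / Real.log r) = (2 - 4 * (2 / Real.log r)) / r := by
          field_simp
          ring
      _ ≤ (2 - 4 * (r ^ 2 * u r)) / r := by gcongr
      _ ≤ _ := hu.le_deriv_inv_sq_mul hr (hpos r hr)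

theorem eventually_sq_mul_sub_le (hu : IsNonnegSolution 4 u) (hpos : ∀ r, 1 < r → 0 < u r) :
    ∀ᶠ r in atTop, r ^ 2 * u r - 1 / (2 * Real.log r) ≤
      9 / 2 * (Real.log (Real.log r) / Real.log r ^ 2) := by
  obtain ⟨C, hC⟩ := hu.exists_eventually_le_inv_sq_mul hpos
  have hloglog : ∀ᶠ t : ℝ in atTop, 9 * Real.log t ≤ t := by
    filter_upwards [Real.isLittleO_log_id_atTop.bound (by norm_num : (0 : ℝ) < 1 / 9),
      eventually_ge_atTop 0] with t ht ht0
    rw [Real.norm_eq_abs, id, Real.norm_of_nonneg ht0] at ht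
    linarith [le_abs_self (Real.log t)]
  filter_upwards [hC, eventually_gt_atTop 1, Real.tendsto_log_atTop.eventually hloglog,
    Real.tendsto_log_atTop.eventually_ge_atTop 1, (Real.tendsto_log_atTop.comp
      Real.tendsto_log_atTop).eventually_ge_atTop (-C)] with r hCr hr hst ht hloglogC
  have hm : 0 < r ^ 2 * u r := mul_pos (by positivity) (hpos r hr)
  have hs := Real.log_nonneg ht
  rw [Function.comp_apply] at hloglogC
  calc r ^ 2 * u r - 1 / (2 * Real.log r)
      ≤ (2 * Real.log r - 9 * Real.log (Real.log r))⁻¹ - 1 / (2 * Real.log r) := by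
        gcongr
        rw [le_inv_comm₀ hm (by linarith)]
        linarith
    _ ≤ 9 * Real.log (Real.log r) / (2 * Real.log r ^ 2) :=
        inv_two_mul_sub_sub_le (by linarith) (by positivity) hst
    _ = 9 / 2 * (Real.log (Real.log r) / Real.log r ^ 2) := by ring

end IsNonnegSolution

namespace IsMaximalNonnegSolution

theorem le_of_four (hu : IsMaximalNonnegSolution 4 u) (hr : 1 < r) :
    1 / 2 * (r ^ 2)⁻¹ * (Real.log (2 * r))⁻¹ ≤ u r := by
  obtain ⟨v, hv, hle⟩ := isGreenSubsolution_log.exists_isNonnegSolution_ge le_rfl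
  exact (hle r hr).trans (hu.le_of_isNonnegSolution v hv r hr)

theorem tendsto_sq_mul_log_mul (hu : IsMaximalNonnegSolution 4 u) :
    Tendsto (fun r : ℝ => r ^ 2 * Real.log r * u r) atTop (𝓝 (1 / 2)) := by
  have hlog := Real.tendsto_log_atTop
  have hupper : Tendsto (fun t : ℝ => 1 / 2 + 9 / 2 * (Real.log t / t)) atTop (𝓝 (1 / 2)) := by
    have hratio : Tendsto (fun t : ℝ => Real.log t / t) atTop (𝓝 0) :=
      Real.isLittleO_log_id_atTop.tendsto_div_nhds_zero
    simpa only [mul_zero, add_zero] using (hratio.const_mul (9 / 2)).const_add (1 / 2)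
  have hlower : Tendsto (fun t : ℝ => 1 / 2 * (1 - Real.log 2 / (Real.log 2 + t))) atTop
      (𝓝 (1 / 2)) := by
    have hratio : Tendsto (fun t : ℝ => Real.log 2 / (Real.log 2 + t)) atTop (𝓝 0) :=
      tendsto_const_nhds.div_atTop (tendsto_atTop_add_const_left _ _ tendsto_id)
    simpa only [sub_zero, mul_one] using (hratio.const_sub 1).const_mul (1 / 2)
  refine tendsto_of_tendsto_of_tendsto_of_le_of_le' (hlower.comp hlog) (hupper.comp hlog) ?_ ?_
  · filter_upwards [eventually_gt_atTop 1] with r hr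
    have hl : 0 < Real.log r := Real.log_pos hr
    calc 1 / 2 * (1 - Real.log 2 / (Real.log 2 + Real.log r))
        = r ^ 2 * Real.log r * (1 / 2 * (r ^ 2)⁻¹ * (Real.log (2 * r))⁻¹) := by
          rw [Real.log_mul two_ne_zero (zero_lt_one.trans hr).ne']
          field_simp
          ring
      _ ≤ r ^ 2 * Real.log r * u r := mul_le_mul_of_nonneg_left (hu.le_of_four hr) (by positivity)
  · filter_upwards [hu.isNonnegSolution.eventually_sq_mul_sub_le fun r hr => hu.pos le_rfl hr,
      eventually_gt_atTop 1] with r hle hr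
    have hl : 0 < Real.log r := Real.log_pos hr
    calc r ^ 2 * Real.log r * u r
        ≤ Real.log r * (1 / (2 * Real.log r) +
            9 / 2 * (Real.log (Real.log r) / Real.log r ^ 2)) := by
          rw [mul_right_comm, mul_comm]
          exact mul_le_mul_of_nonneg_left (sub_le_iff_le_add'.1 hle) hl.le
      _ = 1 / 2 + 9 / 2 * (Real.log (Real.log r) / Real.log r) := by field_simp

theorem exists_forall_le_of_four {r₀ : ℝ} (hr₀ : 1 < r₀) :
    ∃ b₀ : ℝ, 0 < b₀ ∧ ∀ u : ℝ → ℝ, IsMaximalNonnegSolution 4 u →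
      ∀ r : ℝ, r₀ ≤ r → u r ≤ b₀ * (2 * r ^ 2 * Real.log r)⁻¹ := by
  obtain ⟨w, hw⟩ := exists_isMaximalNonnegSolution (d := 4) (by norm_num)
  have hlog0 : ∀ r, r₀ ≤ r → 0 < Real.log r := fun r hr => Real.log_pos (hr₀.trans_le hr)
  obtain ⟨b₀, hb₀, hle⟩ := exists_forall_le_mul_of_eventually_le (ρ := r₀) (C₀ := 2)
    (f := fun r => r ^ 2 * w r) (g := fun r => (2 * Real.log r)⁻¹)
    (fun r hr => (hw.isNonnegSolution.hasDerivAt_sq_mul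
      (hr₀.trans_le hr)).continuousAt.continuousWithinAt)
    (((Real.continuousOn_log.mono fun r hr => (zero_lt_one.trans (hr₀.trans_le hr)).ne').const_smul
      (2 : ℝ)).inv₀ fun r hr => (mul_pos two_pos (hlog0 r hr)).ne')
    (fun r hr => inv_pos.2 (mul_pos two_pos (hlog0 r hr)))
    (by
      filter_upwards [hw.tendsto_sq_mul_log_mul.eventually_le_const one_half_lt_one,
        eventually_ge_atTop r₀] with r hle hr
      have := hlog0 r hr
      rw [← div_eq_mul_inv, le_div_iff₀ (by positivity)]
      linarith)
  refine ⟨b₀, hb₀, fun u hu r hr => ?_⟩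
  have hr1 := hr₀.trans_le hr
  calc u r = (r ^ 2)⁻¹ * (r ^ 2 * w r) := by
        rw [hu.eq hw hr1]
        field_simp
    _ ≤ (r ^ 2)⁻¹ * (b₀ * (2 * Real.log r)⁻¹) :=
        mul_le_mul_of_nonneg_left (hle r hr) (by positivity)
    _ = b₀ * (2 * r ^ 2 * Real.log r)⁻¹ := by
        simp only [mul_inv]
        ring

theorem exists_forall_le_add_of_four {ρ : ℝ} (hρ : Real.exp 1 < ρ) :
    ∃ b₁ : ℝ, 0 < b₁ ∧ ∀ u : ℝ → ℝ, IsMaximalNonnegSolution 4 u → ∀ r : ℝ, ρ ≤ r →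
      u r ≤ 1 / 2 * (r ^ 2)⁻¹ * (Real.log r)⁻¹ +
        b₁ * (r ^ 2)⁻¹ * ((Real.log r) ^ 2)⁻¹ * Real.log (Real.log r) := by
  obtain ⟨w, hw⟩ := exists_isMaximalNonnegSolution (d := 4) (by norm_num)
  have hρ1 : 1 < ρ := (Real.one_lt_exp_iff.2 one_pos).trans hρ
  have hlog1 : ∀ r, ρ ≤ r → 1 < Real.log r := fun r hr =>
    (Real.lt_log_iff_exp_lt (zero_lt_one.trans (hρ1.trans_le hr))).2 (hρ.trans_le hr)
  have hlog : ContinuousOn Real.log (Ici ρ) :=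
    Real.continuousOn_log.mono fun r hr => (zero_lt_one.trans (hρ1.trans_le hr)).ne'
  have hlog0 : ∀ r ∈ Ici ρ, Real.log r ≠ 0 := fun r hr => (zero_lt_one.trans (hlog1 r hr)).ne'
  obtain ⟨b₁, hb₁, hle⟩ := exists_forall_le_mul_of_eventually_le (ρ := ρ) (C₀ := 9 / 2)
    (f := fun r => r ^ 2 * w r - 1 / (2 * Real.log r))
    (g := fun r => Real.log (Real.log r) / Real.log r ^ 2)
    (ContinuousOn.sub (fun r hr => (hw.isNonnegSolution.hasDerivAt_sq_mul
        (hρ1.trans_le hr)).continuousAt.continuousWithinAt)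
      (continuousOn_const.div (hlog.const_smul (2 : ℝ)) fun r hr =>
        mul_ne_zero two_ne_zero (hlog0 r hr)))
    ((hlog.log hlog0).div (hlog.pow 2) fun r hr => pow_ne_zero 2 (hlog0 r hr))
    (fun r hr => div_pos (Real.log_pos (hlog1 r hr)) (pow_pos (zero_lt_one.trans (hlog1 r hr)) 2))
    (hw.isNonnegSolution.eventually_sq_mul_sub_le fun r hr => hw.pos le_rfl hr)
  refine ⟨b₁, hb₁, fun u hu r hr => ?_⟩
  have hr1 := hρ1.trans_le hr
  calc u r = (r ^ 2)⁻¹ * (r ^ 2 * w r) := by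
        rw [hu.eq hw hr1]
        field_simp
    _ ≤ (r ^ 2)⁻¹ * (1 / (2 * Real.log r) +
          b₁ * (Real.log (Real.log r) / Real.log r ^ 2)) :=
        mul_le_mul_of_nonneg_left (sub_le_iff_le_add'.1 (hle r hr)) (by positivity)
    _ = _ := by
        simp only [div_eq_mul_inv, mul_inv]
        ring

end IsMaximalNonnegSolution

end DimensionFour

theorem mainTheorem7_general {r₀ : ℝ} (hr₀ : 1 < r₀) :
    (∀ d : ℕ, 2 ≤ d → ∃ u : ℝ → ℝ, IsMaximalNonnegSolution d u) ∧
    (∀ d : ℕ, 5 ≤ d → ∃ a₀ b₀ b₁ : ℝ, 0 < a₀ ∧ 0 < b₀ ∧ 0 < b₁ ∧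
      ∀ u : ℝ → ℝ, IsMaximalNonnegSolution d u →
        Tendsto (fun r : ℝ => r ^ ((d : ℤ) - 2) * u r) atTop (𝓝 a₀) ∧
        (∀ r : ℝ, 1 < r → a₀ * r ^ (2 - (d : ℤ)) ≤ u r) ∧
        (∀ r : ℝ, r₀ ≤ r → u r ≤ b₀ * r ^ (2 - (d : ℤ))) ∧
        (∀ r : ℝ, r₀ ≤ r →
          u r ≤ a₀ * r ^ (2 - (d : ℤ)) + b₁ * r ^ (6 - 2 * (d : ℤ)))) ∧
    ((∃ b₀ : ℝ, 0 < b₀ ∧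
      ∀ u : ℝ → ℝ, IsMaximalNonnegSolution 4 u →
        Tendsto (fun r : ℝ => r ^ 2 * Real.log r * u r) atTop (𝓝 (1 / 2)) ∧
        (∀ r : ℝ, 1 < r → 1 / 2 * (r ^ 2)⁻¹ * (Real.log (2 * r))⁻¹ ≤ u r) ∧
        (∀ r : ℝ, r₀ ≤ r → u r ≤ b₀ * (2 * r ^ 2 * Real.log r)⁻¹)) ∧
     (∀ ρ : ℝ, Real.exp 1 < ρ → ∃ b₁ : ℝ, 0 < b₁ ∧
      ∀ u : ℝ → ℝ, IsMaximalNonnegSolution 4 u → ∀ r : ℝ, ρ ≤ r →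
        u r ≤ 1 / 2 * (r ^ 2)⁻¹ * (Real.log r)⁻¹ +
          b₁ * (r ^ 2)⁻¹ * ((Real.log r) ^ 2)⁻¹ * Real.log (Real.log r))) := by
  refine ⟨fun d hd => exists_isMaximalNonnegSolution hd,
    fun d hd => IsMaximalNonnegSolution.asymptotics_of_five_le hd hr₀, ?_,
    fun ρ hρ => IsMaximalNonnegSolution.exists_forall_le_add_of_four hρ⟩
  obtain ⟨b₀, hb₀, hle⟩ := IsMaximalNonnegSolution.exists_forall_le_of_four hr₀
  exact ⟨b₀, hb₀, fun u hu => ⟨hu.tendsto_sq_mul_log_mul, fun r hr => hu.le_of_four hr, hle u hu⟩⟩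

theorem mainTheorem7 :
    -- the maximal nonnegative solution exists
    (∀ d : ℕ, 4 ≤ d → ∃ u : ℝ → ℝ, IsMaximalNonnegSolution d u) ∧
    -- dimension at least five
    (∀ d : ℕ, 5 ≤ d → ∃ a₀ b₀ b₁ : ℝ, 0 < a₀ ∧ 0 < b₀ ∧ 0 < b₁ ∧
      ∀ u : ℝ → ℝ, IsMaximalNonnegSolution d u →
        Tendsto (fun r : ℝ => r ^ ((d : ℤ) - 2) * u r) atTop (𝓝 a₀) ∧
        (∀ r : ℝ, 1 < r → a₀ * r ^ (2 - (d : ℤ)) ≤ u r) ∧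
        (∀ r : ℝ, 4 / 3 ≤ r → u r ≤ b₀ * r ^ (2 - (d : ℤ))) ∧
        (∀ r : ℝ, 4 / 3 ≤ r →
          u r ≤ a₀ * r ^ (2 - (d : ℤ)) + b₁ * r ^ (6 - 2 * (d : ℤ)))) ∧
    -- dimension four, where the limit constant is `1 / 2`
    ((∃ b₀ : ℝ, 0 < b₀ ∧
      ∀ u : ℝ → ℝ, IsMaximalNonnegSolution 4 u →
        Tendsto (fun r : ℝ => r ^ 2 * Real.log r * u r) atTop (𝓝 (1 / 2)) ∧
        (∀ r : ℝ, 1 < r → 1 / 2 * (r ^ 2)⁻¹ * (Real.log (2 * r))⁻¹ ≤ u r) ∧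
        (∀ r : ℝ, 4 / 3 ≤ r → u r ≤ b₀ * (2 * r ^ 2 * Real.log r)⁻¹)) ∧
     (∀ ρ : ℝ, Real.exp 1 < ρ → ∃ b₁ : ℝ, 0 < b₁ ∧
      ∀ u : ℝ → ℝ, IsMaximalNonnegSolution 4 u → ∀ r : ℝ, ρ ≤ r →
        u r ≤ 1 / 2 * (r ^ 2)⁻¹ * (Real.log r)⁻¹ +
          b₁ * (r ^ 2)⁻¹ * ((Real.log r) ^ 2)⁻¹ * Real.log (Real.log r))) := by
  obtain ⟨hexists, hasymptotics⟩ := mainTheorem7_general (by norm_num : (1 : ℝ) < 4 / 3)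
  exact ⟨fun d hd => hexists d (le_trans (by norm_num) hd), hasymptotics⟩
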